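/- Let $\lambda$ be a Young diagram, with boxes $(i,j)$, $i,j\ge 1$ (row $i$, column $j$). Let $X=(X_{i,j})_{(i,j)\in\lambda}$ be i.i.d. random variables whose common distribution is either geometric with some parameter $p\in(0,1)$, i.e. $\mathbb{P}(X_{i,j}=m)=p(1-p)^m$ for all integers $m\ge 0$, or exponential of some rate $\alpha>0$. A directed lattice path from $(a,b)$ to $(c,d)$ is a sequence of boxes $(i_0,j_0)=(a,b),\dots,(i_m,j_m)=(c,d)$ of $\lambda$ of minimal length $m=|c-a|+|d-b|$ with $|i_{k+1}-i_k|+|j_{k+1}-j_k|=1$ for $0\le k<m$. The last passage percolation (LPP) time is $$L(a,b;c,d)=\max_{\pi:(a,b)\to(c,d)}\ \sum_{(i,j)\in\pi}X_{i,j},$$ the maximum being over all directed lattice paths $\pi$ from $(a,b)$ to $(c,d)$. The LPP tableau $L$ and the dual LPP tableau $L^*$ are given by $$L_{i,j}=L(1,1;i,j),\qquad L^*_{i,j}=L(i,1;1,j),\qquad (i,j)\in\lambda .$$ The border strip of $\lambda$ is $\mathcal{B}=\{(i,j)\in\lambda:(i+1,j+1)\notin\lambda\}$, and a corner of $\lambda$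 is a box $(i,j)\in\lambda$ such that $\lambda\setminus\{(i,j)\}$ is a Young diagram. Then the border strip entries of $L$ and $L^*$ have the same joint distribution: $$(L_{i,j})_{(i,j)\in\mathcal{B}}\overset{D}{=}(L^*_{i,j})_{(i,j)\in\mathcal{B}} .$$ In particular, the corner entries of $L$ and $L^*$ have the same joint distribution. -/

import Mathlib

open MeasureTheory ProbabilityTheory

namespace YoungLPP

/-- The `ℓ¹` distance `|c - a| + |d - b|` between the boxes `(a, b)` and `(c, d)`. -/
def boxDist (u v : ℕ × ℕ) : ℕ :=
  ((v.1 : ℤ) - (u.1 : ℤ)).natAbs + ((v.2 : ℤ) - (u.2 : ℤ)).natAbs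

/-- A nearest-neighbour lattice path with `m` steps inside the Young diagram `lam`, from the box
`u` to the box `v`. -/
structure IsLatticePath {lam : YoungDiagram} (u v : lam) (m : ℕ) (π : Fin (m + 1) → lam) :
    Prop where
  start : π 0 = u
  finish : π (Fin.last m) = v
  step : ∀ k : Fin m, boxDist (π k.castSucc) (π k.succ) = 1

/-- A directed lattice path is a lattice path with the minimal number of steps. -/
abbrev IsDirectedPath {lam : YoungDiagram} (u v : lam) (π : Fin (boxDist u v + 1) → lam) : Prop :=
  IsLatticePath u v (boxDist u v) π

/-- The total weights that are collected along the directed lattice paths from `u` to `v`. -/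
def pathWeights {lam : YoungDiagram} (x : lam → ℝ) (u v : lam) : Set ℝ :=
  {s | ∃ π : Fin (boxDist u v + 1) → lam, IsDirectedPath u v π ∧ s = ∑ k, x (π k)}

/-- The last passage percolation time `L(u; v)` with weights `x`: the maximum over all directed
lattice paths from `u` to `v` of the sum of the weights along the path. That this supremum is a
maximum is `isGreatest_lpp` below. -/
noncomputable def lpp {lam : YoungDiagram} (x : lam → ℝ) (u v : lam) : ℝ :=
  sSup (pathWeights x u v)

/-- Any two boxes of a Young diagram are joined by a directed lattice path in the diagram. -/
theorem exists_latticePath {lam : YoungDiagram} (v : lam) (m : ℕ) :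
    ∀ u : lam, boxDist u v = m → ∃ π : Fin (m + 1) → lam, IsLatticePath u v m π := by
  obtain ⟨⟨v1, v2⟩, hv⟩ := v
  induction m with
  | zero =>
    rintro ⟨⟨u1, u2⟩, hu⟩ h
    refine ⟨fun _ => ⟨(u1, u2), hu⟩, rfl, ?_, fun k => k.elim0⟩
    simp only [boxDist] at h
    simp only [Subtype.mk.injEq, Prod.mk.injEq]
    omega
  | succ m ih =>
    rintro ⟨⟨u1, u2⟩, hu⟩ h
    have key : ∃ w : lam, boxDist w (v1, v2) = m ∧ boxDist (u1, u2) w = 1 := by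
      simp only [boxDist] at h ⊢
      by_cases h1 : v1 < u1
      · refine ⟨⟨(u1 - 1, u2), lam.up_left_mem (Nat.sub_le _ _) le_rfl hu⟩, ?_, ?_⟩ <;>
          simp only <;> omega
      by_cases h2 : v2 < u2
      · refine ⟨⟨(u1, u2 - 1), lam.up_left_mem le_rfl (Nat.sub_le _ _) hu⟩, ?_, ?_⟩ <;>
          simp only <;> omega
      by_cases h3 : u1 < v1
      · refine ⟨⟨(u1 + 1, u2), lam.up_left_mem h3 (not_lt.mp h2) hv⟩, ?_, ?_⟩ <;>
          simp only <;> omega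
      · refine ⟨⟨(u1, u2 + 1), lam.up_left_mem (not_lt.mp h1) (by omega) hv⟩, ?_, ?_⟩ <;>
          simp only <;> omega
    obtain ⟨w, hw, huw⟩ := key
    obtain ⟨π, hπ⟩ := ih w hw
    refine ⟨Fin.cons ⟨(u1, u2), hu⟩ π, by simp, ?_, fun k => ?_⟩
    · rw [← Fin.succ_last, Fin.cons_succ]
      exact hπ.finish
    · refine Fin.cases ?_ (fun k => ?_) k
      · simpa [hπ.start] using huw
      · simpa [← Fin.succ_castSucc] using hπ.step k

/-- The last passage time is a genuine maximum, for all boxes and all weights. -/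
theorem isGreatest_lpp {lam : YoungDiagram} (x : lam → ℝ) (u v : lam) :
    IsGreatest (pathWeights x u v) (lpp x u v) := by
  have : Finite lam := inferInstanceAs (Finite lam.cells)
  have hfin : (pathWeights x u v).Finite :=
    (Set.finite_range fun π : Fin (boxDist u v + 1) → lam => ∑ k, x (π k)).subset
      (by rintro s ⟨π, -, rfl⟩; exact ⟨π, rfl⟩)
  have hne : (pathWeights x u v).Nonempty := by
    obtain ⟨π, hπ⟩ := exists_latticePath v _ u rfl
    exact ⟨_, π, hπ, rfl⟩
  exact ⟨hne.csSup_mem hfin, fun s hs => le_csSup hfin.bddAbove hs⟩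

/-- The first box of the row of `c`. -/
def rowStart {lam : YoungDiagram} (c : lam) : lam :=
  ⟨(c.1.1, 0), lam.up_left_mem le_rfl (Nat.zero_le _) c.2⟩

/-- The first box of the column of `c`. -/
def colStart {lam : YoungDiagram} (c : lam) : lam :=
  ⟨(0, c.1.2), lam.up_left_mem (Nat.zero_le _) le_rfl c.2⟩

/-- The top left box of a diagram that has a box `c`. -/
def origin {lam : YoungDiagram} (c : lam) : lam :=
  ⟨(0, 0), lam.up_left_mem (Nat.zero_le _) (Nat.zero_le _) c.2⟩

/-- The LPP tableau: with boxes numbered from `1`, its entry at `(i, j)` is `L(1, 1; i, j)`.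
(Mathlib numbers rows and columns from `0`.) -/
noncomputable def lppTableau {lam : YoungDiagram} (x : lam → ℝ) (c : lam) : ℝ :=
  lpp x (origin c) c

/-- The dual LPP tableau: with boxes numbered from `1`, its entry at `(i, j)` is
`L(i, 1; 1, j)`. -/
noncomputable def dualLppTableau {lam : YoungDiagram} (x : lam → ℝ) (c : lam) : ℝ :=
  lpp x (rowStart c) (colStart c)

/-- The border strip: the boxes `(i, j)` of the diagram with `(i + 1, j + 1)` not in it. -/
def borderStrip (lam : YoungDiagram) : Set lam :=
  {c | (c.1.1 + 1, c.1.2 + 1) ∉ lam}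

/-- The corners: the boxes whose removal leaves a Young diagram. -/
def corners (lam : YoungDiagram) : Set lam :=
  {c | ∃ ν : YoungDiagram, ν.cells = lam.cells.erase c.1}

/-- The geometric distribution on `{0, 1, 2, …}`, giving mass `p * (1 - p) ^ m` to `m`, as a
measure on `ℝ`. -/
noncomputable def geometricReal (p : unitInterval) : Measure ℝ :=
  (geometricMeasure p).map (fun n : ℕ => (n : ℝ))

end YoungLPP

/-!
The border strips of the two tableaux are compared by a bijection between nonnegative integer
weights on the boxes of the diagram that preserves the total weight. Under independent geometric
weights all configurations with the same total weight are equally likely, so such a bijection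
preserves the law (`map_geometricWeights`).

The bijection is the Robinson-Schensted-Knuth correspondence followed by the inverse of the Burge
correspondence, both realised by growth diagrams. Such a diagram attaches a partition to each
vertex of the lattice: for each box, a local rule computes the partition `la` at its lower right
vertex from the partitions `mu`, `nu`, `ka` at the lower left, upper right and upper left vertices
and from the weight `w` of the box. For fixed `mu` and `nu`, the two rules `rskRule` and
`burgeRule` are bijections `(ka, w) ↦ la` with the same domain and the same image, both described
by interlacing, and both satisfy `|la| + |ka| = |mu| + |nu| + w`. Removing corners one at a time,
it follows that under either rule the weights on the diagram correspond bijectively to the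
interlacing families of partitions along its boundary (`existsUnique_filling`), and that such a
family determines the total weight (`sum_filling_eq`).

It remains to identify the largest parts along the boundary. For `rskRule` they satisfy the
recursion of the last passage times from the origin (`lppTableau_le_iff`). For `burgeRule`, adding
a row of weights is a sequence of two-line queueing steps that sort the new row into the stack of
lines formed by the parts of each index, and each step preserves all last passage times through the
two lines (`IsSorting.lineStep_lineStep`). Hence the lines of parts have the same last passage
times as the rows of weights in reversed order, and the largest part is the dual last passage time
(`stack_rows_iff`, `dualLppTableau_le_iff`).

Exponential weights are limits of scaled geometric weights, since the integer part of an
exponential random variable is geometric (`map_floor_expMeasure`, `map_lppTableau_exponential`).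
-/

namespace YoungLPP

/-! ### Local growth rules -/

/-- A nonnegative integer sequence whose entries of index `r` and above vanish. A partition with at
most `r` parts is such a sequence; monotonicity is not required, since it follows from interlacing
wherever it matters. -/
def IsShape (r : ℕ) (a : ℕ → ℤ) : Prop :=
  (∀ k, 0 ≤ a k) ∧ ∀ k, r ≤ k → a k = 0

/-- The sequences `a` and `b` interlace, `b 0 ≥ a 0 ≥ b 1 ≥ a 1 ≥ …`: for partitions, `b / a` is a
horizontal strip. -/
def Interlaces (a b : ℕ → ℤ) : Prop :=
  ∀ k, a k ≤ b k ∧ b (k + 1) ≤ a k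

/-- The pairs `(ka, w)` that a growth rule in row `r` accepts as input, given the shapes `mu` and
`nu`: a shape `ka` that interlaces with both, and a nonnegative weight `w`. -/
structure IsInput (r : ℕ) (mu nu ka : ℕ → ℤ) (w : ℤ) : Prop where
  shape : IsShape r ka
  left : Interlaces ka mu
  up : Interlaces ka nu
  nonneg : 0 ≤ w

/-- The shapes `la` that a growth rule in row `r` may produce, given the shapes `mu` and `nu`. -/
structure IsOutput (r : ℕ) (mu nu la : ℕ → ℤ) : Prop where
  shape : IsShape (r + 1) la
  left : Interlaces mu la
  up : Interlaces nu la

/-- A local growth rule: a family of maps `R r mu nu ka w` (row index `r`, left, upper and diagonal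
neighbours `mu`, `nu`, `ka`, weight `w`) which, for fixed `mu` and `nu`, is a bijection from the
pairs `(ka, w)` to the shapes `la` that interlace with `mu` and `nu`, and for which
`|la| + |ka| = |mu| + |nu| + w`. -/
structure IsGrowthRule (R : ℕ → (ℕ → ℤ) → (ℕ → ℤ) → (ℕ → ℤ) → ℤ → ℕ → ℤ) : Prop where
  output : ∀ {r mu nu ka w}, IsShape (r + 1) mu → IsShape r nu → IsInput r mu nu ka w →
    IsOutput r mu nu (R r mu nu ka w)
  exists_input : ∀ {r mu nu la}, IsShape (r + 1) mu → IsShape r nu → IsOutput r mu nu la →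
    ∃ ka w, IsInput r mu nu ka w ∧ R r mu nu ka w = la
  injective : ∀ {r mu nu ka w ka' w'}, IsShape (r + 1) mu → IsShape r nu →
    IsInput r mu nu ka w → IsInput r mu nu ka' w' →
    R r mu nu ka w = R r mu nu ka' w' → ka = ka' ∧ w = w'
  size : ∀ {r mu nu ka w}, IsShape (r + 1) mu → IsShape r nu → IsInput r mu nu ka w →
    ∀ N, r < N → ∑ k ∈ Finset.range N, R r mu nu ka w k + ∑ k ∈ Finset.range N, ka k =
      ∑ k ∈ Finset.range N, mu k + ∑ k ∈ Finset.range N, nu k + w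

/-- The local rule of the Robinson-Schensted-Knuth correspondence (row insertion). -/
def rskRule (_ : ℕ) (mu nu ka : ℕ → ℤ) (w : ℤ) : ℕ → ℤ
  | 0 => max (mu 0) (nu 0) + w
  | k + 1 => max (mu (k + 1)) (nu (k + 1)) + min (mu k) (nu k) - ka k

/-- The quantity that is carried upwards through the parts in the Burge local rule, from the
smallest part to the largest; `n` counts the levels that lie below the level `k`. -/
def burgeCarry (mu nu ka : ℕ → ℤ) (w : ℤ) : ℕ → ℕ → ℤ
  | 0, _ => w
  | n + 1, k => mu k + nu k - 2 * ka k + max (ka k) (burgeCarry mu nu ka w n (k + 1))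

/-- The local rule of the Burge correspondence (column insertion). The weight enters below the last
part that can be nonzero. -/
def burgeRule (r : ℕ) (mu nu ka : ℕ → ℤ) (w : ℤ) : ℕ → ℤ
  | 0 => burgeCarry mu nu ka w (r + 1) 0
  | k + 1 => min (ka k) (burgeCarry mu nu ka w (r - k) (k + 1))

theorem rskRule_isGrowthRule : IsGrowthRule rskRule where
  output := by
    rintro r mu nu ka w ⟨hm0, hm⟩ ⟨hn0, hn⟩ ⟨⟨hk0, hk⟩, hl, hu, hw⟩
    refine ⟨⟨fun k => ?_, fun k hrk => ?_⟩, fun k => ?_, fun k => ?_⟩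
    · rcases k with _ | k
      · have := hm0 0
        simp only [rskRule]
        omega
      · have := hm0 (k + 1)
        have := hl k
        have := hu k
        simp only [rskRule]
        omega
    · obtain ⟨k, rfl⟩ : ∃ l, k = l + 1 := ⟨k - 1, by omega⟩
      have := hm (k + 1) (by omega)
      have := hn (k + 1) (by omega)
      have := hn k (by omega)
      have := hk k (by omega)
      have := hm0 k
      simp only [rskRule]
      omega
    · have := hl k
      have := hu k
      rcases k with _ | k
      · simp only [rskRule]
        omega
      · have := hl (k + 1)
        have := hl k
        have := hu k
        simp only [rskRule]
        omega
    · have := hl k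
      have := hu k
      rcases k with _ | k
      · simp only [rskRule]
        omega
      · have := hl (k + 1)
        have := hl k
        have := hu k
        simp only [rskRule]
        omega
  exists_input := by
    rintro r mu nu la ⟨hm0, hm⟩ ⟨hn0, hn⟩ ⟨⟨hl0, hla⟩, hl, hu⟩
    refine ⟨fun k => max (mu (k + 1)) (nu (k + 1)) + min (mu k) (nu k) - la (k + 1),
      la 0 - max (mu 0) (nu 0), ⟨⟨fun k => ?_, fun k hrk => ?_⟩, fun k => ?_, fun k => ?_, ?_⟩, ?_⟩
    · have := hl k
      have := hu k
      have := hm0 (k + 1)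
      dsimp only
      omega
    · have := hm (k + 1) (by omega)
      have := hn (k + 1) (by omega)
      have := hn k hrk
      have := hm0 k
      have := hla (k + 1) (by omega)
      dsimp only
      omega
    · have := hl k
      have := hu k
      have := hl (k + 1)
      have := hu (k + 1)
      omega
    · have := hl k
      have := hu k
      have := hl (k + 1)
      have := hu (k + 1)
      omega
    · have := hl 0
      have := hu 0
      omega
    · funext k
      rcases k with _ | k <;> simp only [rskRule] <;> omega
  injective := by
    intro r mu nu ka w ka' w' _ _ _ _ h
    refine ⟨funext fun k => ?_, ?_⟩
    · have := congrFun h (k + 1)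
      simp only [rskRule] at this
      omega
    · have := congrFun h 0
      simp only [rskRule] at this
      omega
  size := by
    rintro r mu nu ka w ⟨hm0, hm⟩ ⟨hn0, hn⟩ ⟨⟨hk0, hk⟩, hl, hu, hw⟩ N hN
    -- the partial sums miss `min (mu n) (nu n)` and `ka n`, which vanish for `n ≥ r`
    have key : ∀ n, ∑ k ∈ Finset.range (n + 1), rskRule r mu nu ka w k +
        ∑ k ∈ Finset.range n, ka k + min (mu n) (nu n) =
        ∑ k ∈ Finset.range (n + 1), mu k + ∑ k ∈ Finset.range (n + 1), nu k + w := by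
      intro n
      induction n with
      | zero =>
        simp only [zero_add, Finset.sum_range_one, Finset.sum_range_zero, rskRule]
        omega
      | succ n ih =>
        rw [Finset.sum_range_succ _ (n + 1), Finset.sum_range_succ ka n,
          Finset.sum_range_succ mu (n + 1), Finset.sum_range_succ nu (n + 1)]
        simp only [rskRule] at ih ⊢
        omega
    obtain ⟨n, rfl⟩ : ∃ n, N = n + 1 := ⟨N - 1, by omega⟩
    have h1 := key n
    have h2 := hn n (by omega)
    have h3 := hk n (by omega)
    have h4 := hm0 n
    rw [Finset.sum_range_succ ka n]
    omega

/-- The value that `burgeCarry` must have at level `k` if `burgeRule` produces the shape `la`. -/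
def burgeUncarry (mu nu la : ℕ → ℤ) : ℕ → ℤ
  | 0 => la 0
  | k + 1 => burgeUncarry mu nu la k - mu k - nu k +
      max (la (k + 1)) (mu k + nu k - burgeUncarry mu nu la k) + la (k + 1)

theorem le_burgeUncarry (mu nu la : ℕ → ℤ) (k : ℕ) : la k ≤ burgeUncarry mu nu la k := by
  cases k <;> simp only [burgeUncarry] <;> omega

/-- A preimage of a shape under the Burge rule carries `burgeUncarry`, and its diagonal shape can be
read off from that. -/
theorem burgeCarry_eq_uncarry {r : ℕ} {mu nu ka la : ℕ → ℤ} {w : ℤ}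
    (h : burgeRule r mu nu ka w = la) :
    ∀ k ≤ r + 1, burgeCarry mu nu ka w (r + 1 - k) k = burgeUncarry mu nu la k ∧
      (k ≤ r → ka k = max (la (k + 1)) (mu k + nu k - burgeUncarry mu nu la k)) := by
  have step : ∀ k ≤ r, burgeCarry mu nu ka w (r + 1 - k) k = burgeUncarry mu nu la k →
      ka k = max (la (k + 1)) (mu k + nu k - burgeUncarry mu nu la k) ∧
      burgeCarry mu nu ka w (r + 1 - (k + 1)) (k + 1) = burgeUncarry mu nu la (k + 1) := by
    intro k hk hc
    have h1 := congrFun h (k + 1)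
    rw [show r + 1 - k = (r - k) + 1 by omega] at hc
    rw [show r + 1 - (k + 1) = r - k by omega]
    simp only [burgeRule, burgeCarry, burgeUncarry] at h1 hc ⊢
    omega
  have main : ∀ k ≤ r + 1,
      burgeCarry mu nu ka w (r + 1 - k) k = burgeUncarry mu nu la k := by
    intro k
    induction k with
    | zero => intro _; exact congrFun h 0
    | succ k ih => intro hk; exact (step k (by omega) (ih (by omega))).2
  exact fun k hk => ⟨main k hk, fun hkr => (step k hkr (main k hk)).1⟩

theorem burgeRule_isGrowthRule : IsGrowthRule burgeRule where
  output := by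
    rintro r mu nu ka w ⟨hm0, hm⟩ ⟨hn0, hn⟩ ⟨⟨hk0, hk⟩, hl, hu, hw⟩
    have hc : ∀ k, mu k ≤ burgeCarry mu nu ka w (r + 1 - k) k ∧
        nu k ≤ burgeCarry mu nu ka w (r + 1 - k) k := by
      intro k
      have := hl k
      have := hu k
      by_cases hkr : k ≤ r
      · rw [show r + 1 - k = (r - k) + 1 by omega, burgeCarry]
        omega
      · have := hm k (by omega)
        have := hn k (by omega)
        rw [show r + 1 - k = 0 by omega, burgeCarry]
        omega
    have hc' : ∀ k, mu (k + 1) ≤ burgeCarry mu nu ka w (r - k) (k + 1) ∧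
        nu (k + 1) ≤ burgeCarry mu nu ka w (r - k) (k + 1) := by
      intro k
      have := hc (k + 1)
      rwa [show r + 1 - (k + 1) = r - k by omega] at this
    refine ⟨⟨fun k => ?_, fun k hrk => ?_⟩, fun k => ?_, fun k => ?_⟩
    · rcases k with _ | k
      · exact (hm0 0).trans (hc 0).1
      · exact le_min (hk0 k) ((hm0 _).trans (hc' k).1)
    · obtain ⟨k, rfl⟩ : ∃ l, k = l + 1 := ⟨k - 1, by omega⟩
      have := hk k (by omega)
      have := hc' k
      have := hm0 (k + 1)
      simp only [burgeRule]
      omega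
    · have := hl k
      refine ⟨?_, (min_le_left _ _).trans this.1⟩
      rcases k with _ | k
      · exact (hc 0).1
      · exact le_min (hl k).2 (hc' k).1
    · have := hu k
      refine ⟨?_, (min_le_left _ _).trans this.1⟩
      rcases k with _ | k
      · exact (hc 0).2
      · exact le_min (hu k).2 (hc' k).2
  exists_input := by
    rintro r mu nu la ⟨hm0, hm⟩ ⟨hn0, hn⟩ ⟨⟨hl0, hla⟩, hl, hu⟩
    set H := burgeUncarry mu nu la with hH
    have hle : ∀ k, la k ≤ H k := le_burgeUncarry mu nu la
    set ka : ℕ → ℤ := fun k => max (la (k + 1)) (mu k + nu k - H k) with hka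
    have hcarry : ∀ n k, n + k = r + 1 → burgeCarry mu nu ka (H (r + 1)) n k = H k := by
      intro n
      induction n with
      | zero => intro k hk; rw [burgeCarry, show k = r + 1 by omega]
      | succ n ih =>
        intro k hk
        rw [burgeCarry, ih (k + 1) (by omega)]
        simp only [hka, hH, burgeUncarry]
        omega
    refine ⟨ka, H (r + 1), ⟨⟨fun k => ?_, fun k hrk => ?_⟩, fun k => ?_, fun k => ?_, ?_⟩, ?_⟩
    · exact (hl0 (k + 1)).trans (le_max_left _ _)
    · have := hn k hrk
      have := hla (k + 1) (by omega)
      have := hl k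
      have := hle k
      simp only [hka]
      omega
    · have := hl k
      have := hu k
      have := hle k
      have := hl (k + 1)
      simp only [hka]
      omega
    · have := hl k
      have := hu k
      have := hle k
      have := hu (k + 1)
      simp only [hka]
      omega
    · exact (hl0 _).trans (hle _)
    · funext k
      rcases k with _ | k
      · exact hcarry (r + 1) 0 rfl
      · by_cases hkr : k ≤ r
        · rw [burgeRule, hcarry _ _ (by omega)]
          simp only [hka, hH, burgeUncarry]
          omega
        · have := hla (k + 1) (by omega)
          have := hn k (by omega)
          have := hl k
          have := hle k
          have := hl0 (r + 1)
          have := hle (r + 1)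
          rw [burgeRule, show r - k = 0 by omega, burgeCarry]
          simp only [hka]
          omega
  injective := by
    rintro r mu nu ka w ka' w' - - ⟨⟨-, hk⟩, -⟩ ⟨⟨-, hk'⟩, -⟩ h
    have h1 := burgeCarry_eq_uncarry h
    have h2 := burgeCarry_eq_uncarry (r := r) (mu := mu) (nu := nu) (ka := ka') (w := w') rfl
    refine ⟨funext fun k => ?_, ?_⟩
    · by_cases hkr : k ≤ r
      · rw [(h1 k (by omega)).2 hkr, (h2 k (by omega)).2 hkr]
      · rw [hk k (by omega), hk' k (by omega)]
    · have h3 := (h1 (r + 1) le_rfl).1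
      rw [← (h2 (r + 1) le_rfl).1, Nat.sub_self] at h3
      simpa only [burgeCarry] using h3
  size := by
    rintro r mu nu ka w ⟨hm0, hm⟩ ⟨hn0, hn⟩ ⟨⟨hk0, hk⟩, hl, hu, hw⟩ N hN
    have key : ∀ n, ∑ k ∈ Finset.range (n + 1), burgeRule r mu nu ka w k +
        ∑ k ∈ Finset.range n, ka k = ∑ k ∈ Finset.range n, mu k +
          ∑ k ∈ Finset.range n, nu k + burgeCarry mu nu ka w (r + 1 - n) n := by
      intro n
      induction n with
      | zero => simp [burgeRule]
      | succ n ih =>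
        rw [Finset.sum_range_succ _ (n + 1), Finset.sum_range_succ ka n,
          Finset.sum_range_succ mu n, Finset.sum_range_succ nu n]
        by_cases hnr : n ≤ r
        · rw [show r + 1 - n = (r - n) + 1 by omega] at ih
          rw [show r + 1 - (n + 1) = r - n by omega]
          simp only [burgeRule, burgeCarry] at ih ⊢
          omega
        · have := hm n (by omega)
          have := hn n (by omega)
          have := hk n (by omega)
          rw [show r + 1 - n = 0 by omega] at ih
          rw [show r + 1 - (n + 1) = 0 by omega]
          simp only [burgeRule, burgeCarry, show r - n = 0 by omega] at ih ⊢
          omega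
    obtain ⟨n, rfl⟩ : ∃ n, N = n + 1 := ⟨N - 1, by omega⟩
    have h1 := key (n + 1)
    have h2 := hk n (by omega)
    rw [Finset.sum_range_succ _ (n + 1), show r + 1 - (n + 1) = 0 by omega] at h1
    simp only [burgeRule, burgeCarry, show r - n = 0 by omega] at h1 ⊢
    omega

/-! ### Growth diagrams -/

/-- The growth diagram of the weights `x` under the local rule `R`: the shape at the vertex `(i, j)`
depends on the weights in the first `i` rows and `j` columns. -/
def growth (R : ℕ → (ℕ → ℤ) → (ℕ → ℤ) → (ℕ → ℤ) → ℤ → ℕ → ℤ) (x : ℕ → ℕ → ℤ) :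
    ℕ → ℕ → ℕ → ℤ
  | 0, _ => 0
  | _ + 1, 0 => 0
  | i + 1, j + 1 => R i (growth R x (i + 1) j) (growth R x i (j + 1)) (growth R x i j) (x i j)

section Growth

variable {R : ℕ → (ℕ → ℤ) → (ℕ → ℤ) → (ℕ → ℤ) → ℤ → ℕ → ℤ}

theorem growth_zero_left (x : ℕ → ℕ → ℤ) (j : ℕ) : growth R x 0 j = 0 := by
  rw [growth]

theorem growth_zero_right (x : ℕ → ℕ → ℤ) (i : ℕ) : growth R x i 0 = 0 := by
  cases i <;> rw [growth]

theorem growth_succ (x : ℕ → ℕ → ℤ) (i j : ℕ) : growth R x (i + 1) (j + 1) =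
    R i (growth R x (i + 1) j) (growth R x i (j + 1)) (growth R x i j) (x i j) := by
  rw [growth]

theorem growth_congr {x y : ℕ → ℕ → ℤ} (i j : ℕ) (h : ∀ a < i, ∀ b < j, x a b = y a b) :
    growth R x i j = growth R y i j := by
  induction i generalizing j with
  | zero => simp only [growth_zero_left]
  | succ i ihi =>
    induction j with
    | zero => simp only [growth_zero_right]
    | succ j ihj =>
      rw [growth_succ, growth_succ, ihj fun a ha b hb => h a ha b (by omega),
        ihi (j + 1) fun a ha b hb => h a (by omega) b hb,
        ihi j fun a ha b hb => h a (by omega) b (by omega), h i (by omega) j (by omega)]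

theorem isShape_zero (r : ℕ) : IsShape r 0 :=
  ⟨fun _ => le_rfl, fun _ _ => rfl⟩

theorem interlaces_zero : Interlaces 0 0 :=
  fun _ => ⟨le_rfl, le_rfl⟩

theorem growth_shape_interlaces (hR : IsGrowthRule R) {x : ℕ → ℕ → ℤ} (hx : ∀ i j, 0 ≤ x i j)
    (i : ℕ) : ∀ j, IsShape i (growth R x i j) ∧
      Interlaces (growth R x i j) (growth R x i (j + 1)) ∧
      Interlaces (growth R x i j) (growth R x (i + 1) j) := by
  have row : ∀ i, (∀ j, IsShape i (growth R x i j) ∧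
      Interlaces (growth R x i j) (growth R x i (j + 1))) →
      ∀ j, IsShape (i + 1) (growth R x (i + 1) j) ∧
        Interlaces (growth R x i j) (growth R x (i + 1) j) ∧
        Interlaces (growth R x (i + 1) j) (growth R x (i + 1) (j + 1)) := by
    intro i ih j
    have out : ∀ j, IsShape (i + 1) (growth R x (i + 1) j) →
        Interlaces (growth R x i j) (growth R x (i + 1) j) →
        IsOutput i (growth R x (i + 1) j) (growth R x i (j + 1))
          (growth R x (i + 1) (j + 1)) := by
      intro j hs hv
      rw [growth_succ x i j]
      exact hR.output hs (ih (j + 1)).1 ⟨(ih j).1, hv, (ih j).2, hx i j⟩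
    have hsv : IsShape (i + 1) (growth R x (i + 1) j) ∧
        Interlaces (growth R x i j) (growth R x (i + 1) j) := by
      induction j with
      | zero =>
        rw [growth_zero_right, growth_zero_right]
        exact ⟨isShape_zero _, interlaces_zero⟩
      | succ j ihj => exact ⟨(out j ihj.1 ihj.2).shape, (out j ihj.1 ihj.2).up⟩
    exact ⟨hsv.1, hsv.2, (out j hsv.1 hsv.2).left⟩
  have main : ∀ i j, IsShape i (growth R x i j) ∧
      Interlaces (growth R x i j) (growth R x i (j + 1)) := by
    intro i
    induction i with
    | zero =>
      intro j
      rw [growth_zero_left, growth_zero_left]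
      exact ⟨isShape_zero _, interlaces_zero⟩
    | succ i ih => exact fun j => ⟨(row i ih j).1, (row i ih j).2.2⟩
  exact fun j => ⟨(main i j).1, (main i j).2, (row i (main i) j).2.1⟩

theorem growth_isInput (hR : IsGrowthRule R) {x : ℕ → ℕ → ℤ} (hx : ∀ i j, 0 ≤ x i j)
    (i j : ℕ) : IsInput i (growth R x (i + 1) j) (growth R x i (j + 1)) (growth R x i j) (x i j) :=
  have h := growth_shape_interlaces hR hx i j
  ⟨h.1, h.2.2, h.2.1, hx i j⟩

/-- The size of the shape at a vertex is the total weight of the rectangle above and to its left. -/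
theorem sum_growth (hR : IsGrowthRule R) {x : ℕ → ℕ → ℤ} (hx : ∀ i j, 0 ≤ x i j) (N i j : ℕ)
    (hi : i ≤ N) : ∑ k ∈ Finset.range N, growth R x i j k =
      ∑ a ∈ Finset.range i, ∑ b ∈ Finset.range j, x a b := by
  induction i generalizing j with
  | zero => simp [growth_zero_left]
  | succ i ihi =>
    induction j with
    | zero => simp [growth_zero_right]
    | succ j ihj =>
      have h := hR.size (growth_shape_interlaces hR hx (i + 1) j).1
        (growth_shape_interlaces hR hx i (j + 1)).1 (growth_isInput hR hx i j) N (by omega)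
      rw [← growth_succ (R := R) x i j, ihj, ihi (j + 1) (by omega), ihi j (by omega)] at h
      rw [Finset.sum_range_succ _ i] at h ⊢
      rw [Finset.sum_range_succ _ j]
      omega

/-! ### Growth diagrams over a Young diagram -/

/-- The vertices that are the lower right corner of a box of `lam`, or lie on an axis, but are not
the upper left corner of a box of `lam`. (The box `(i, j)` has upper left corner `(i, j)` and
lower right corner `(i + 1, j + 1)`.) Off the axes they correspond to the boxes of the border
strip. -/
def boundary (lam : YoungDiagram) : Set (ℕ × ℕ) :=
  {v | v ∉ lam ∧ ∀ a b, v = (a + 1, b + 1) → (a, b) ∈ lam}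

/-- Nonnegative integer weights that vanish outside `lam`. -/
structure IsFilling (lam : YoungDiagram) (x : ℕ → ℕ → ℤ) : Prop where
  nonneg : ∀ i j, 0 ≤ x i j
  support : ∀ i j, (i, j) ∉ lam → x i j = 0

/-- A family of shapes along the boundary of `lam` in which neighbours interlace. Only the values of
`g` on the boundary matter. -/
structure IsBoundaryData (lam : YoungDiagram) (g : ℕ → ℕ → ℕ → ℤ) : Prop where
  shape : ∀ {i j}, (i, j) ∈ boundary lam → IsShape i (g i j)
  zero : ∀ {i}, (i, 0) ∈ boundary lam → g i 0 = 0
  row : ∀ {i j}, (i, j) ∈ boundary lam → (i, j + 1) ∈ boundary lam →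
    Interlaces (g i j) (g i (j + 1))
  col : ∀ {i j}, (i, j) ∈ boundary lam → (i + 1, j) ∈ boundary lam →
    Interlaces (g i j) (g (i + 1) j)

theorem isBoundaryData_growth (hR : IsGrowthRule R) {lam : YoungDiagram} {x : ℕ → ℕ → ℤ}
    (hx : IsFilling lam x) : IsBoundaryData lam (growth R x) where
  shape _ := (growth_shape_interlaces hR hx.nonneg _ _).1
  zero _ := growth_zero_right x _
  row _ _ := (growth_shape_interlaces hR hx.nonneg _ _).2.1
  col _ _ := (growth_shape_interlaces hR hx.nonneg _ _).2.2

theorem exists_corner (lam : YoungDiagram) (h : lam.cells.Nonempty) :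
    ∃ a b, (a, b) ∈ lam ∧ (a + 1, b) ∉ lam ∧ (a, b + 1) ∉ lam := by
  obtain ⟨⟨a, b⟩, hc, hmax⟩ := Finset.exists_max_image lam.cells (fun c => c.1 + c.2) h
  refine ⟨a, b, hc, fun h' => ?_, fun h' => ?_⟩
  · have := hmax _ h'
    simp only at this
    omega
  · have := hmax _ h'
    simp only at this
    omega

/-- The diagram `lam` without a corner box. -/
def eraseCorner (lam : YoungDiagram) (a b : ℕ) (h1 : (a + 1, b) ∉ lam) (h2 : (a, b + 1) ∉ lam) :
    YoungDiagram where
  cells := lam.cells.erase (a, b)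
  isLowerSet := by
    rintro ⟨i, j⟩ ⟨i', j'⟩ hle hmem
    obtain ⟨hi, hj⟩ := Prod.mk_le_mk.mp hle
    simp only [Finset.coe_erase, Set.mem_sdiff, Set.mem_singleton_iff, Finset.mem_coe,
      YoungDiagram.mem_cells, Prod.mk.injEq] at hmem ⊢
    refine ⟨lam.up_left_mem hi hj hmem.1, ?_⟩
    rintro ⟨rfl, rfl⟩
    rcases lt_or_eq_of_le hi with hi | rfl
    · exact h1 (lam.up_left_mem hi hj hmem.1)
    · rcases lt_or_eq_of_le hj with hj | rfl
      · exact h2 (lam.up_left_mem hi hj hmem.1)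
      · exact hmem.2 ⟨rfl, rfl⟩

section Corner

variable {lam : YoungDiagram} {a b : ℕ} {h1 : (a + 1, b) ∉ lam} {h2 : (a, b + 1) ∉ lam}

theorem mem_eraseCorner {i j : ℕ} :
    (i, j) ∈ eraseCorner lam a b h1 h2 ↔ (i, j) ≠ (a, b) ∧ (i, j) ∈ lam := by
  rw [← YoungDiagram.mem_cells, eraseCorner, Finset.mem_erase, YoungDiagram.mem_cells]

theorem mem_boundary_eraseCorner (h : (a, b) ∈ lam) {i j : ℕ} :
    (i, j) ∈ boundary (eraseCorner lam a b h1 h2) ↔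
      (i, j) = (a, b) ∨ (i, j) ∈ boundary lam ∧ (i, j) ≠ (a + 1, b + 1) := by
  simp only [boundary, Set.mem_ofPred_eq, mem_eraseCorner]
  constructor
  · rintro ⟨hij, hpred⟩
    by_cases hc : (i, j) = (a, b)
    · exact Or.inl hc
    · refine Or.inr ⟨⟨fun hm => hij ⟨hc, hm⟩, fun a' b' h' => (hpred a' b' h').2⟩, fun h' => ?_⟩
      exact (hpred a b h').1 rfl
  · rintro (hc | ⟨⟨hij, hpred⟩, hne⟩)
    · obtain ⟨rfl, rfl⟩ := Prod.mk.inj hc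
      refine ⟨fun h' => h'.1 rfl, fun a' b' h' => ?_⟩
      obtain ⟨rfl, rfl⟩ := Prod.mk.inj h'
      refine ⟨fun h'' => ?_, lam.up_left_mem (by omega) (by omega) h⟩
      obtain ⟨h3, -⟩ := Prod.mk.inj h''
      omega
    · refine ⟨fun h' => hij h'.2, fun a' b' h' => ⟨fun h'' => ?_, hpred a' b' h'⟩⟩
      obtain ⟨rfl, rfl⟩ := Prod.mk.inj h''
      exact hne h'

/-- The weight of a removed corner does not influence the shapes on the remaining boundary. -/
theorem growth_congr_boundary_eraseCorner {x y : ℕ → ℕ → ℤ}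
    (hxy : ∀ i j, (i, j) ≠ (a, b) → x i j = y i j) {i j : ℕ}
    (hij : (i, j) ∈ boundary (eraseCorner lam a b h1 h2)) : growth R x i j = growth R y i j := by
  refine growth_congr i j fun c hc d hd => hxy c d ?_
  rintro h
  obtain ⟨rfl, rfl⟩ := Prod.mk.inj h
  have h3 := hij.2 (i - 1) (j - 1)
    (by rw [Nat.sub_add_cancel (by omega), Nat.sub_add_cancel (by omega)])
  have h4 := (eraseCorner lam c d h1 h2).up_left_mem (i1 := c) (j1 := d) (by omega) (by omega) h3
  exact (mem_eraseCorner.mp h4).1 rfl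

end Corner

/-- A growth rule induces a bijection between the fillings of a Young diagram and the interlacing
families of shapes along its boundary. -/
theorem existsUnique_filling (hR : IsGrowthRule R) (lam : YoungDiagram) (g : ℕ → ℕ → ℕ → ℤ)
    (hg : IsBoundaryData lam g) :
    ∃! x, IsFilling lam x ∧ ∀ i j, (i, j) ∈ boundary lam → growth R x i j = g i j := by
  induction hn : lam.cells.card generalizing lam g with
  | zero =>
    have hempty : ∀ v, v ∉ lam := by
      intro v hv
      rw [Finset.card_eq_zero] at hn
      rw [← YoungDiagram.mem_cells, hn] at hv
      simp at hv
    refine ⟨0, ⟨⟨fun _ _ => le_rfl, fun _ _ _ => rfl⟩, fun i j hij => ?_⟩, fun y hy => ?_⟩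
    · rcases i with _ | i
      · rw [growth_zero_left]
        exact (funext fun k => (hg.shape hij).2 k (Nat.zero_le _)).symm
      · rcases j with _ | j
        · rw [growth_zero_right, hg.zero hij]
        · exact absurd (hij.2 i j rfl) (hempty _)
    · funext i j
      exact hy.1.support i j (hempty _)
  | succ n ih =>
    obtain ⟨a, b, hc, h1, h2⟩ := exists_corner lam (Finset.card_pos.mp (by omega))
    set lam' := eraseCorner lam a b h1 h2 with hlam'
    have hcard : lam'.cells.card = n := by
      have := Finset.card_erase_of_mem ((YoungDiagram.mem_cells (a, b)).mpr hc)
      simp only [hlam', eraseCorner]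
      omega
    have hmu : (a + 1, b) ∈ boundary lam :=
      ⟨h1, fun a' b' h' => lam.up_left_mem (by grind) (by grind) hc⟩
    have hnu : (a, b + 1) ∈ boundary lam :=
      ⟨h2, fun a' b' h' => lam.up_left_mem (by grind) (by grind) hc⟩
    have hla : (a + 1, b + 1) ∈ boundary lam :=
      ⟨fun h' => h1 (lam.up_left_mem le_rfl (Nat.le_succ _) h'), fun a' b' h' => by grind⟩
    have hmu' : (a + 1, b) ∈ boundary lam' :=
      (mem_boundary_eraseCorner hc).mpr (Or.inr ⟨hmu, by simp⟩)
    have hnu' : (a, b + 1) ∈ boundary lam' :=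
      (mem_boundary_eraseCorner hc).mpr (Or.inr ⟨hnu, by simp⟩)
    have hka' : (a, b) ∈ boundary lam' := (mem_boundary_eraseCorner hc).mpr (Or.inl rfl)
    have hout : IsOutput a (g (a + 1) b) (g a (b + 1)) (g (a + 1) (b + 1)) :=
      ⟨hg.shape hla, hg.row hmu hla, hg.col hnu hla⟩
    obtain ⟨ka, w, hin, hkw⟩ := hR.exists_input (hg.shape hmu) (hg.shape hnu) hout
    -- the boundary data of the smaller diagram: `ka` replaces the shape at the removed corner
    set g' : ℕ → ℕ → ℕ → ℤ := fun i j => if (i, j) = (a, b) then ka else g i j with hg'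
    have hg'c : g' a b = ka := by simp [hg']
    have hg'n : ∀ {i j}, (i, j) ≠ (a, b) → g' i j = g i j := fun h => by simp only [hg', if_neg h]
    have hdata : IsBoundaryData lam' g' := by
      have hold : ∀ {i j}, (i, j) ∈ boundary lam' → (i, j) ≠ (a, b) → (i, j) ∈ boundary lam :=
        fun h h' => ((mem_boundary_eraseCorner hc).mp h).resolve_left h' |>.1
      have hup : ∀ {i j}, (i, j) ∈ boundary lam' → (i, j) ∈ lam → (i, j) = (a, b) := by
        intro i j h h'
        by_contra hne
        exact (hold h hne).1 h'
      constructor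
      · intro i j hij
        by_cases h : (i, j) = (a, b)
        · obtain ⟨rfl, rfl⟩ := Prod.mk.inj h
          rw [hg'c]
          exact hin.shape
        · rw [hg'n h]
          exact hg.shape (hold hij h)
      · intro i hi
        by_cases h : (i, 0) = (a, b)
        · obtain ⟨rfl, rfl⟩ := Prod.mk.inj h
          rw [hg'c]
          funext k
          have h3 := (hin.left k).1
          have h4 := hin.shape.1 k
          rw [hg.zero hmu] at h3
          exact le_antisymm h3 h4
        · rw [hg'n h]
          exact hg.zero (hold hi h)
      · intro i j h3 h4
        by_cases h : (i, j) = (a, b)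
        · obtain ⟨rfl, rfl⟩ := Prod.mk.inj h
          rw [hg'c, hg'n (by simp)]
          exact hin.up
        · by_cases h' : (i, j + 1) = (a, b)
          · refine absurd (hup h3 ?_) h
            obtain ⟨rfl, rfl⟩ := Prod.mk.inj h'
            exact lam.up_left_mem le_rfl (Nat.le_succ _) hc
          · rw [hg'n h, hg'n h']
            exact hg.row (hold h3 h) (hold h4 h')
      · intro i j h3 h4
        by_cases h : (i, j) = (a, b)
        · obtain ⟨rfl, rfl⟩ := Prod.mk.inj h
          rw [hg'c, hg'n (by simp)]
          exact hin.left
        · by_cases h' : (i + 1, j) = (a, b)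
          · refine absurd (hup h3 ?_) h
            obtain ⟨rfl, rfl⟩ := Prod.mk.inj h'
            exact lam.up_left_mem (Nat.le_succ _) le_rfl hc
          · rw [hg'n h, hg'n h']
            exact hg.col (hold h3 h) (hold h4 h')
    obtain ⟨x, ⟨hx, hxg⟩, huniq⟩ := ih lam' g' hdata hcard
    set y : ℕ → ℕ → ℤ := fun i j => if (i, j) = (a, b) then w else x i j with hy
    have hyc : y a b = w := by simp [hy]
    have hyn : ∀ i j, (i, j) ≠ (a, b) → y i j = x i j := fun i j h => by simp only [hy, if_neg h]
    have hyg : ∀ i j, (i, j) ∈ boundary lam' → growth R y i j = g' i j := fun i j hij => by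
      rw [growth_congr_boundary_eraseCorner hyn hij, hxg i j hij]
    refine ⟨y, ⟨⟨fun i j => ?_, fun i j hij => ?_⟩, fun i j hij => ?_⟩, ?_⟩
    · by_cases h : (i, j) = (a, b)
      · obtain ⟨rfl, rfl⟩ := Prod.mk.inj h
        rw [hyc]
        exact hin.nonneg
      · rw [hyn i j h]
        exact hx.nonneg i j
    · have h : (i, j) ≠ (a, b) := fun h => hij (h ▸ hc)
      rw [hyn i j h]
      exact hx.support i j fun h' => hij (mem_eraseCorner.mp h').2
    · by_cases h : (i, j) = (a + 1, b + 1)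
      · obtain ⟨rfl, rfl⟩ := Prod.mk.inj h
        rw [growth_succ, hyg _ _ hmu', hyg _ _ hnu', hyg _ _ hka', hg'c, hg'n (by simp),
          hg'n (by simp), hyc, hkw]
      · rw [hyg i j ((mem_boundary_eraseCorner hc).mpr (Or.inr ⟨hij, h⟩)), hg'n]
        exact fun h' => hij.1 (h' ▸ hc)
    · rintro z ⟨hz, hzg⟩
      have hzla := hzg _ _ hla
      have hzin := growth_isInput hR hz.nonneg a b
      rw [growth_succ, hzg _ _ hmu, hzg _ _ hnu] at hzla
      rw [hzg _ _ hmu, hzg _ _ hnu] at hzin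
      obtain ⟨hka, hw⟩ := hR.injective (hg.shape hmu) (hg.shape hnu) hzin hin (hzla.trans hkw.symm)
      -- the filling `z` without the corner is the unique filling of the smaller diagram
      set z' : ℕ → ℕ → ℤ := fun i j => if (i, j) = (a, b) then 0 else z i j with hz'
      have hz'n : ∀ i j, (i, j) ≠ (a, b) → z' i j = z i j :=
        fun i j h => by simp only [hz', if_neg h]
      have hz'x : z' = x := by
        refine huniq z' ⟨⟨fun i j => ?_, fun i j hij => ?_⟩, fun i j hij => ?_⟩
        · by_cases h : (i, j) = (a, b)
          · simp only [hz', if_pos h, le_refl]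
          · rw [hz'n i j h]
            exact hz.nonneg i j
        · by_cases h : (i, j) = (a, b)
          · simp only [hz', if_pos h]
          · rw [hz'n i j h]
            exact hz.support i j fun h' => hij (mem_eraseCorner.mpr ⟨h, h'⟩)
        · rw [growth_congr_boundary_eraseCorner hz'n hij]
          by_cases h : (i, j) = (a, b)
          · obtain ⟨rfl, rfl⟩ := Prod.mk.inj h
            rw [hg'c, hka]
          · rw [hg'n h]
            exact hzg i j (((mem_boundary_eraseCorner hc).mp hij).resolve_left h).1
      funext i j
      by_cases h : (i, j) = (a, b)
      · obtain ⟨rfl, rfl⟩ := Prod.mk.inj h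
        rw [hyc, hw]
      · rw [hyn i j h, ← hz'x, hz'n i j h]

/-- The total weight of a filling is determined by the sizes of its shapes along the boundary: the
sum of row `i` is the difference of two of them. -/
theorem sum_filling_eq {R' : ℕ → (ℕ → ℤ) → (ℕ → ℤ) → (ℕ → ℤ) → ℤ → ℕ → ℤ} (hR : IsGrowthRule R)
    (hR' : IsGrowthRule R') {lam : YoungDiagram} {x y : ℕ → ℕ → ℤ} (hx : IsFilling lam x)
    (hy : IsFilling lam y)
    (h : ∀ i j, (i, j) ∈ boundary lam → growth R x i j = growth R' y i j) :
    ∑ c ∈ lam.cells, x c.1 c.2 = ∑ c ∈ lam.cells, y c.1 c.2 := by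
  have rows : ∀ i, ∑ j ∈ Finset.range (lam.rowLen i), x i j =
      ∑ j ∈ Finset.range (lam.rowLen i), y i j := by
    intro i
    by_cases h0 : lam.rowLen i = 0
    · simp [h0]
    have hm : (i, lam.rowLen i - 1) ∈ lam := YoungDiagram.mem_iff_lt_rowLen.mpr (by omega)
    have hn : (i, lam.rowLen i) ∉ lam := fun h' =>
      lt_irrefl _ (YoungDiagram.mem_iff_lt_rowLen.mp h')
    have b1 : (i, lam.rowLen i) ∈ boundary lam :=
      ⟨hn, fun a b h' => lam.up_left_mem (by grind) (by grind) hm⟩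
    have b2 : (i + 1, lam.rowLen i) ∈ boundary lam :=
      ⟨fun h' => hn (lam.up_left_mem (Nat.le_succ _) le_rfl h'),
        fun a b h' => lam.up_left_mem (by grind) (by grind) hm⟩
    have e1 := sum_growth hR hx.nonneg (i + 1) i (lam.rowLen i) (Nat.le_succ _)
    have e2 := sum_growth hR hx.nonneg (i + 1) (i + 1) (lam.rowLen i) le_rfl
    rw [h _ _ b1, sum_growth hR' hy.nonneg (i + 1) i (lam.rowLen i) (Nat.le_succ _)] at e1
    rw [h _ _ b2, sum_growth hR' hy.nonneg (i + 1) (i + 1) (lam.rowLen i) le_rfl,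
      Finset.sum_range_succ, Finset.sum_range_succ] at e2
    omega
  have cells : ∀ z : ℕ → ℕ → ℤ, ∑ c ∈ lam.cells, z c.1 c.2 =
      ∑ i ∈ lam.cells.image Prod.fst, ∑ j ∈ Finset.range (lam.rowLen i), z i j := by
    intro z
    refine Finset.sum_finset_product' _ _ _ fun c => ?_
    rw [Finset.mem_range, ← YoungDiagram.mem_iff_lt_rowLen, ← YoungDiagram.mem_cells]
    exact ⟨fun hc => ⟨Finset.mem_image_of_mem _ hc, hc⟩, fun hc => hc.2⟩
  rw [cells, cells]
  exact Finset.sum_congr rfl fun i _ => rows i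

end Growth

/-! ### Last passage times through stacks of lines -/

/-- Let `P a b z` say that all paths that cross some stack of lines, entering it at position `a` and
leaving it at position `b`, have weight at most `z`. Then `lineStep U P` says the same for the stack
with a further line in front, on which the weights have the partial sums `U`. -/
def lineStep (U : ℕ → ℤ) (P : ℕ → ℕ → ℤ → Prop) (a b : ℕ) (z : ℤ) : Prop :=
  ∀ k, a ≤ k → k ≤ b → P k b (z - (U (k + 1) - U a))

/-- The bound on the paths through the lines with partial sums `T (n - 1), …, T 0`, crossed in this
order. The empty stack is treated as a line without weights. -/
def stack (T : ℕ → ℕ → ℤ) : ℕ → ℕ → ℕ → ℤ → Prop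
  | 0 => fun _ _ z => 0 ≤ z
  | n + 1 => lineStep (T n) (stack T n)

theorem stack_mono (T : ℕ → ℕ → ℤ) (n a b : ℕ) {z z' : ℤ} (h : z ≤ z') (hz : stack T n a b z) :
    stack T n a b z' := by
  induction n generalizing a z z' with
  | zero => exact le_trans (b := z) hz h
  | succ n ih => exact fun k hk hkb => ih k (by omega) (hz k hk hkb)

/-- A queueing step for two lines with partial sums `U` and `V`: `V'` is the last passage time
through `U` and then `V`, and `U'` is what is left over, so that `U' + V' = U + V`. Equivalently,
`V' - V` is the running maximum of `0` and the differences `U (k + 1) - V k`. -/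
structure IsSorting (U V U' V' : ℕ → ℤ) : Prop where
  zero : V 0 = 0
  zero' : V' 0 = 0
  step : ∀ j, V' (j + 1) = max (V' j) (U (j + 1)) + (V (j + 1) - V j)
  add : ∀ j, U' j + V' j = U j + V j

section Sorting

variable {U V U' V' : ℕ → ℤ}

theorem IsSorting.le (h : IsSorting U V U' V') {a b : ℕ} (hab : a ≤ b) :
    V' a - V a ≤ V' b - V b := by
  induction b, hab using Nat.le_induction with
  | base => exact le_rfl
  | succ b _ ih =>
    have := h.step b
    omega

/-- The running maximum `V' - V` either does not change from `a` to `b + 1`, or there is a first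
position at which it jumps. -/
theorem IsSorting.eq_or_jump (h : IsSorting U V U' V') {a b : ℕ} (hab : a ≤ b) :
    V' (b + 1) - V (b + 1) = V' a - V a ∨
      ∃ k, a ≤ k ∧ k ≤ b ∧ V' k - V k = V' a - V a ∧
        U (k + 1) - V k = V' (k + 1) - V (k + 1) := by
  induction b, hab using Nat.le_induction with
  | base =>
    have := h.step a
    by_cases hc : V' (a + 1) - V (a + 1) = V' a - V a
    · exact Or.inl hc
    · exact Or.inr ⟨a, le_rfl, le_rfl, rfl, by omega⟩
  | succ b hab ih =>
    have := h.step (b + 1)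
    rcases ih with ih | ⟨k, hk, hkb, h1, h2⟩
    · by_cases hc : V' (b + 1 + 1) - V (b + 1 + 1) = V' a - V a
      · exact Or.inl hc
      · exact Or.inr ⟨b + 1, by omega, le_rfl, ih, by omega⟩
    · exact Or.inr ⟨k, hk, by omega, h1, h2⟩

/-- The running maximum `V' - V` either does not change from `a` to `b + 1`, or its final value is
attained in between. -/
theorem IsSorting.eq_or_attained (h : IsSorting U V U' V') {a b : ℕ} (hab : a ≤ b) :
    V' (b + 1) - V (b + 1) = V' a - V a ∨
      ∃ k, a ≤ k ∧ k ≤ b ∧ U (k + 1) - V k = V' (b + 1) - V (b + 1) := by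
  induction b, hab using Nat.le_induction with
  | base =>
    have := h.step a
    by_cases hc : V' (a + 1) - V (a + 1) = V' a - V a
    · exact Or.inl hc
    · exact Or.inr ⟨a, le_rfl, le_rfl, by omega⟩
  | succ b hab ih =>
    have := h.step (b + 1)
    by_cases hc : V' (b + 1 + 1) - V (b + 1 + 1) = V' (b + 1) - V (b + 1)
    · rcases ih with ih | ⟨k, hk, hkb, h1⟩
      · exact Or.inl (by omega)
      · exact Or.inr ⟨k, hk, by omega, by omega⟩
    · exact Or.inr ⟨b + 1, by omega, le_rfl, by omega⟩

/-- Sorting does not decrease the last passage time through the two lines between any two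
positions. -/
theorem IsSorting.exists_le (h : IsSorting U V U' V') {a b k : ℕ} (hk : a ≤ k) (hkb : k ≤ b) :
    ∃ l, a ≤ l ∧ l ≤ b ∧ U (k + 1) - U a + (V (b + 1) - V k) ≤
      U' (l + 1) - U' a + (V' (b + 1) - V' l) := by
  have ha := h.add a
  have hmk := h.le hk
  have hmk1 := h.le (Nat.le_succ k)
  have hmb := h.le (show k + 1 ≤ b + 1 by omega)
  have hs := h.step k
  rcases h.eq_or_jump (hk.trans hkb) with he | ⟨l, hl, hlb, h1, h2⟩
  · have := h.add (k + 1)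
    exact ⟨k, hk, hkb, by simp only [Nat.succ_eq_add_one] at *; omega⟩
  · have := h.add (l + 1)
    exact ⟨l, hl, hlb, by simp only [Nat.succ_eq_add_one] at *; omega⟩

/-- Sorting does not increase the last passage time through the two lines between any two
positions. -/
theorem IsSorting.exists_ge (h : IsSorting U V U' V') {a b k : ℕ} (hk : a ≤ k) (hkb : k ≤ b) :
    ∃ l, a ≤ l ∧ l ≤ b ∧ U' (k + 1) - U' a + (V' (b + 1) - V' k) ≤
      U (l + 1) - U a + (V (b + 1) - V l) := by
  have ha := h.add a
  have hk1 := h.add (k + 1)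
  have hmk := h.le hk
  have hmk1 := h.le (Nat.le_succ k)
  have hmb := h.le (show k + 1 ≤ b + 1 by omega)
  have hs := h.step k
  rcases h.eq_or_attained (hk.trans hkb) with he | ⟨l, hl, hlb, h1⟩
  · exact ⟨k, hk, hkb, by simp only [Nat.succ_eq_add_one] at *; omega⟩
  · exact ⟨l, hl, hlb, by simp only [Nat.succ_eq_add_one] at *; omega⟩

/-- Sorting two adjacent lines of a stack preserves all its last passage times. -/
theorem IsSorting.lineStep_lineStep (h : IsSorting U V U' V') {P : ℕ → ℕ → ℤ → Prop}
    (hP : ∀ a b {z z'}, z ≤ z' → P a b z → P a b z') :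
    lineStep U (lineStep V P) = lineStep U' (lineStep V' P) := by
  funext a b z
  refine propext ⟨fun hz k hk hkb l hl hlb => ?_, fun hz k hk hkb l hl hlb => ?_⟩
  · obtain ⟨k', h1, h2, h3⟩ := h.exists_ge hk hl
    exact hP l b (by omega) (hz k' h1 (by omega) l h2 hlb)
  · obtain ⟨k', h1, h2, h3⟩ := h.exists_le hk hl
    exact hP l b (by omega) (hz k' h1 (by omega) l h2 hlb)

/-- For paths that start at the first position, the two lines may be replaced by the single line
`V'`. -/
theorem IsSorting.lineStep_lineStep_zero (h : IsSorting U V U' V') (hU : U 0 = 0) (hU1 : 0 ≤ U 1)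
    {P : ℕ → ℕ → ℤ → Prop} (hP : ∀ a b {z z'}, z ≤ z' → P a b z → P a b z') (b : ℕ) (z : ℤ) :
    lineStep U (lineStep V P) 0 b z ↔ lineStep V' P 0 b z := by
  have hV := h.zero
  have hV' := h.zero'
  constructor
  · intro hz l _ hlb
    rcases h.eq_or_attained (Nat.zero_le l) with he | ⟨k, -, hkl, h1⟩
    · exact hP l b (by simp only [zero_add]; omega)
        (hz 0 le_rfl (Nat.zero_le _) l (Nat.zero_le _) hlb)
    · exact hP l b (by omega) (hz k (Nat.zero_le _) (by omega) l hkl hlb)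
  · intro hz k _ hkb l hl hlb
    have h1 := h.le (show k + 1 ≤ l + 1 by omega)
    have h2 := h.step k
    exact hP l b (by omega) (hz l (Nat.zero_le _) hlb)

end Sorting

/-! ### The largest part of the Burge growth diagram -/

/-- The line that is carried upwards when row `i` is inserted into the shapes of the first `i` rows,
just after it has met the line of the parts of index `k`; for `k = i` it is still row `i` itself. -/
def carryLine (x : ℕ → ℕ → ℤ) (i k j : ℕ) : ℤ :=
  ∑ l ∈ Finset.range (k + 1), growth burgeRule x (i + 1) j l -
    ∑ l ∈ Finset.range k, growth burgeRule x i j l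

section Burge

variable {x : ℕ → ℕ → ℤ}

theorem carryLine_succ (i k j : ℕ) : carryLine x i (k + 1) j + growth burgeRule x i j k =
    growth burgeRule x (i + 1) j (k + 1) + carryLine x i k j := by
  simp only [carryLine]
  rw [Finset.sum_range_succ _ (k + 1), Finset.sum_range_succ (growth burgeRule x i j) k]
  ring

theorem carryLine_zero_right (i k : ℕ) : carryLine x i k 0 = 0 := by
  simp [carryLine, growth_zero_right]

theorem carryLine_zero (i j : ℕ) : carryLine x i 0 j = growth burgeRule x (i + 1) j 0 := by
  simp [carryLine]

theorem carryLine_nonneg (hx : ∀ i j, 0 ≤ x i j) (i k j : ℕ) : 0 ≤ carryLine x i k j := by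
  rw [carryLine, Finset.sum_range_succ, add_sub_right_comm, ← Finset.sum_sub_distrib]
  refine add_nonneg (Finset.sum_nonneg fun l _ => ?_)
    ((growth_shape_interlaces burgeRule_isGrowthRule hx (i + 1) j).1.1 k)
  exact sub_nonneg.mpr ((growth_shape_interlaces burgeRule_isGrowthRule hx i j).2.2 l).1

/-- The last carried line is the inserted row itself. -/
theorem carryLine_last (hx : ∀ i j, 0 ≤ x i j) (i j : ℕ) :
    carryLine x i i j = ∑ b ∈ Finset.range j, x i b := by
  rw [carryLine, sum_growth burgeRule_isGrowthRule hx _ _ _ le_rfl,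
    sum_growth burgeRule_isGrowthRule hx _ _ _ le_rfl, Finset.sum_range_succ, add_sub_cancel_left]

theorem carryLine_add_one (i j k : ℕ) (hk : k ≤ i + 1) :
    carryLine x i k (j + 1) + growth burgeRule x (i + 1) j k = carryLine x i k j +
      burgeCarry (growth burgeRule x (i + 1) j) (growth burgeRule x i (j + 1))
        (growth burgeRule x i j) (x i j) (i + 1 - k) k := by
  induction k with
  | zero =>
    rw [carryLine_zero, carryLine_zero, growth_succ, burgeRule]
    exact add_comm _ _
  | succ k ih =>
    have h1 := ih (by omega)
    have h2 := carryLine_succ (x := x) i k j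
    have h3 := carryLine_succ (x := x) i k (j + 1)
    have h4 := congrFun (growth_succ (R := burgeRule) x i j) (k + 1)
    rw [show i + 1 - k = (i - k) + 1 by omega] at h1
    rw [show i + 1 - (k + 1) = i - k by omega]
    simp only [burgeRule, burgeCarry] at h1 h4
    omega

/-- Inserting a row by the Burge rule is a sequence of sortings of the carried line with the lines
of parts, from the smallest part to the largest. -/
theorem isSorting_carryLine (i k : ℕ) (hk : k < i) :
    IsSorting (carryLine x i (k + 1)) (fun j => growth burgeRule x i j k)
      (fun j => growth burgeRule x (i + 1) j (k + 1)) (carryLine x i k) where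
  zero := by simp [growth_zero_right]
  zero' := carryLine_zero_right i k
  step j := by
    have h1 := carryLine_add_one (x := x) i j k (by omega)
    have h2 := carryLine_add_one (x := x) i j (k + 1) (by omega)
    have h3 := carryLine_succ (x := x) i k j
    rw [show i + 1 - k = (i - k) + 1 by omega] at h1
    rw [show i + 1 - (k + 1) = i - k by omega] at h2
    simp only [burgeCarry] at h1
    omega
  add j := (carryLine_succ i k j).symm

/-- The lines of parts after the insertion of row `i` have the same last passage times as row `i`
followed by the lines of parts before it. -/
theorem lineStep_carryLine_stack (i k : ℕ) (hk : k ≤ i) :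
    lineStep (carryLine x i k) (stack (fun l j => growth burgeRule x i j l) k) =
      stack (fun l j => growth burgeRule x (i + 1) j l) (k + 1) := by
  induction k with
  | zero =>
    rw [stack, show carryLine x i 0 = fun j => growth burgeRule x (i + 1) j 0 from
      funext fun j => carryLine_zero i j]
    rfl
  | succ k ih =>
    rw [stack, (isSorting_carryLine i k hk).lineStep_lineStep (stack_mono _ k), ih (by omega)]
    rfl

/-- The rows of weights, from row `i - 1` up to row `0`, have the same last passage times as the
lines of parts of the Burge growth diagram. -/
theorem stack_rows (hx : ∀ i j, 0 ≤ x i j) (i : ℕ) :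
    stack (fun l j => ∑ b ∈ Finset.range j, x l b) i =
      stack (fun l j => growth burgeRule x i j l) i := by
  induction i with
  | zero => rfl
  | succ i ih =>
    rw [← lineStep_carryLine_stack i i le_rfl, stack, ih]
    congr 1
    exact (funext fun j => carryLine_last hx i j).symm

theorem growth_zero_mono {R : ℕ → (ℕ → ℤ) → (ℕ → ℤ) → (ℕ → ℤ) → ℤ → ℕ → ℤ} (hR : IsGrowthRule R)
    (hx : ∀ i j, 0 ≤ x i j) (i k : ℕ) : Monotone fun j => growth R x i j k :=
  monotone_nat_of_le_succ fun j => ((growth_shape_interlaces hR hx i j).2.1 k).1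

/-- The largest part in the Burge growth diagram is the last passage time through the rows of
weights in reversed order. -/
theorem stack_rows_iff (hx : ∀ i j, 0 ≤ x i j) (i b : ℕ) (z : ℤ) :
    stack (fun l j => ∑ b ∈ Finset.range j, x l b) (i + 1) 0 b z ↔
      growth burgeRule x (i + 1) (b + 1) 0 ≤ z := by
  have main : ∀ k ≤ i, lineStep (carryLine x i k)
      (stack (fun l j => growth burgeRule x i j l) k) 0 b z ↔
        growth burgeRule x (i + 1) (b + 1) 0 ≤ z := by
    intro k
    induction k with
    | zero =>
      intro _
      simp only [lineStep, stack, carryLine_zero, growth_zero_right, Pi.zero_apply, sub_zero,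
        sub_nonneg]
      refine ⟨fun h => h b (Nat.zero_le _) le_rfl, fun h k _ hkb => le_trans ?_ h⟩
      exact growth_zero_mono burgeRule_isGrowthRule hx (i + 1) 0 (by omega)
    | succ k ih =>
      intro hk
      rw [← ih (by omega)]
      exact (isSorting_carryLine i k hk).lineStep_lineStep_zero (carryLine_zero_right _ _)
        (carryLine_nonneg hx _ _ _) (stack_mono _ k) b z
  rw [← main i le_rfl, lineStep_carryLine_stack i i le_rfl, stack_rows hx]

end Burge

/-! ### Recursion for last passage times -/

section Lpp

variable {lam : YoungDiagram}

theorem boxDist_comm (u v : ℕ × ℕ) : boxDist u v = boxDist v u := by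
  simp only [boxDist]
  omega

theorem IsLatticePath.rev {u v : lam} {m : ℕ} {π : Fin (m + 1) → lam} (h : IsLatticePath u v m π) :
    IsLatticePath v u m (π ∘ Fin.rev) where
  start := by simpa using h.finish
  finish := by simpa using h.start
  step k := by
    rw [boxDist_comm]
    simpa [Fin.rev_castSucc, Fin.rev_succ] using h.step k.rev

theorem pathWeights_subset_comm (x : lam → ℝ) (u v : lam) :
    pathWeights x u v ⊆ pathWeights x v u := by
  rintro s ⟨π, hπ, rfl⟩
  rw [IsDirectedPath] at hπ
  have hrev := hπ.rev
  have hsum : ∑ k, x (π k) = ∑ k, x ((π ∘ Fin.rev) k) :=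
    (Equiv.sum_comp Fin.revPerm fun k => x (π k)).symm
  rw [hsum]
  generalize π ∘ Fin.rev = π' at hrev
  clear hsum hπ π
  generalize hm : boxDist u v = m at *
  rw [boxDist_comm] at hm
  subst hm
  exact ⟨π', hrev, rfl⟩

/-- Last passage times are symmetric, by reversal of paths. -/
theorem lpp_comm (x : lam → ℝ) (u v : lam) : lpp x u v = lpp x v u :=
  congrArg sSup ((pathWeights_subset_comm x u v).antisymm (pathWeights_subset_comm x v u))

theorem IsLatticePath.tail {u v : lam} {m : ℕ} {π : Fin (m + 1 + 1) → lam}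
    (h : IsLatticePath u v (m + 1) π) : IsLatticePath (π 1) v m (Fin.tail π) where
  start := rfl
  finish := h.finish
  step k := h.step k.succ

theorem IsLatticePath.boxDist_le {u v : lam} {m : ℕ} {π : Fin (m + 1) → lam}
    (h : IsLatticePath u v m π) : boxDist u v ≤ m := by
  induction m generalizing u with
  | zero =>
    have : u = v := h.start.symm.trans h.finish
    simp [this, boxDist]
  | succ m ih =>
    have h1 := ih h.tail
    have h2 := h.step 0
    rw [Fin.castSucc_zero, h.start, Fin.succ_zero_eq_one] at h2
    simp only [boxDist] at h1 h2 ⊢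
    omega

theorem IsLatticePath.cons {u w v : lam} {m : ℕ} {π : Fin (m + 1) → lam}
    (h : IsLatticePath w v m π) (huw : boxDist u w = 1) :
    IsLatticePath u v (m + 1) (Fin.cons u π) where
  start := rfl
  finish := by
    rw [← Fin.succ_last, Fin.cons_succ]
    exact h.finish
  step k := by
    refine Fin.cases ?_ (fun k => ?_) k
    · simpa [h.start] using huw
    · simpa [← Fin.succ_castSucc] using h.step k

theorem lpp_self (x : lam → ℝ) (u : lam) : lpp x u u = x u := by
  obtain ⟨⟨π, hπ, h⟩, -⟩ := isGreatest_lpp x u u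
  have h0 : boxDist u u = 0 := by simp [boxDist]
  have hall : ∀ k, π k = u := by
    intro k
    rw [show k = 0 from Fin.ext (by have h1 := k.2; rw [Fin.val_zero]; omega)]
    exact hπ.start
  rw [h, Finset.sum_congr rfl fun k _ => congrArg x (hall k)]
  simp [h0]

/-- First step decomposition: a bound on a last passage time is a bound on the last passage times
from all boxes to which the first step of a directed path may go. -/
theorem lpp_le_iff (x : lam → ℝ) {u v : lam} (huv : boxDist u v ≠ 0) (z : ℝ) :
    lpp x u v ≤ z ↔
      ∀ w : lam, boxDist u w = 1 → boxDist w v + 1 = boxDist u v → lpp x w v ≤ z - x u := by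
  constructor
  · intro h w h1 h2
    obtain ⟨⟨π, hπ, hw⟩, -⟩ := isGreatest_lpp x w v
    have hmem : x u + lpp x w v ∈ pathWeights x u v := by
      rw [hw]
      have hc := IsLatticePath.cons (u := u) hπ h1
      have hs : x u + ∑ k, x (π k) =
          ∑ k, x ((Fin.cons u π : Fin (boxDist w v + 1 + 1) → lam) k) :=
        (Fin.sum_univ_succ fun k => x ((Fin.cons u π : Fin (boxDist w v + 1 + 1) → lam) k)).symm
      rw [hs]
      generalize (Fin.cons u π : Fin (boxDist w v + 1 + 1) → lam) = π' at hc
      clear hs hw hπ π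
      generalize boxDist w v + 1 = m at *
      subst h2
      exact ⟨π', hc, rfl⟩
    have := (isGreatest_lpp x u v).2 hmem
    linarith
  · intro h
    obtain ⟨⟨π, hπ, hu⟩, -⟩ := isGreatest_lpp x u v
    have key : ∃ m, boxDist u v = m + 1 ∧ ∃ w : lam, boxDist u w = 1 ∧ ∃ π' : Fin (m + 1) → lam,
        IsLatticePath w v m π' ∧ ∑ k, x (π k) = x u + ∑ k, x (π' k) := by
      obtain ⟨m, hm⟩ := Nat.exists_eq_succ_of_ne_zero huv
      refine ⟨m, hm, ?_⟩
      rw [IsDirectedPath] at hπ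
      clear hu h
      generalize boxDist u v = n at *
      subst hm
      have h1 := hπ.step 0
      rw [Fin.castSucc_zero, hπ.start, Fin.succ_zero_eq_one] at h1
      refine ⟨π 1, h1, Fin.tail π, hπ.tail, ?_⟩
      rw [Fin.sum_univ_succ, hπ.start]
      rfl
    obtain ⟨m, hm, w, huw, π', hπ', hs⟩ := key
    have hwv : boxDist w v = m := by
      have h3 := hπ'.boxDist_le
      simp only [boxDist] at hm huw h3 ⊢
      omega
    subst hwv
    have h4 := h w huw hm.symm
    have h5 := (isGreatest_lpp x w v).2 ⟨π', hπ', rfl⟩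
    linarith

/-- The largest part in the growth diagram of the Robinson-Schensted-Knuth correspondence obeys the
recursion of the last passage times from the origin, here read along reversed paths. -/
theorem lppTableau_le_iff {x : ℕ → ℕ → ℤ} (hx : ∀ i j, 0 ≤ x i j) (i j : ℕ) (h : (i, j) ∈ lam)
    (z : ℤ) : lppTableau (fun c : lam => (x c.1.1 c.1.2 : ℝ)) ⟨(i, j), h⟩ ≤ z ↔
      growth rskRule x (i + 1) (j + 1) 0 ≤ z := by
  have hnn : ∀ i j, 0 ≤ growth rskRule x i j 0 := fun i j =>
    (growth_shape_interlaces rskRule_isGrowthRule hx i j).1.1 0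
  rw [lppTableau, lpp_comm]
  change lpp _ _ (⟨(0, 0), _⟩ : lam) ≤ _ ↔ _
  induction hn : i + j generalizing i j z with
  | zero =>
    obtain ⟨rfl, rfl⟩ : i = 0 ∧ j = 0 := by omega
    rw [lpp_self, growth_succ, growth_zero_left, growth_zero_right]
    simp [rskRule]
  | succ n ih =>
    rw [lpp_le_iff _ (by simp only [boxDist]; omega), growth_succ, rskRule]
    have hx0 := hx i j
    have hcast : (z : ℝ) - (x i j : ℝ) = ((z - x i j : ℤ) : ℝ) := by push_cast; ring
    constructor
    · intro hw
      have hup : growth rskRule x i (j + 1) 0 ≤ z - x i j ∨ i = 0 := by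
        rcases i with _ | i
        · exact Or.inr rfl
        · refine Or.inl ((ih i j (lam.up_left_mem (Nat.le_succ _) le_rfl h) _ (by omega)).mp ?_)
          rw [← hcast]
          exact hw ⟨(i, j), lam.up_left_mem (Nat.le_succ _) le_rfl h⟩
            (by simp only [boxDist]; omega) (by simp only [boxDist]; omega)
      have hleft : growth rskRule x (i + 1) j 0 ≤ z - x i j ∨ j = 0 := by
        rcases j with _ | j
        · exact Or.inr rfl
        · refine Or.inl ((ih i j (lam.up_left_mem le_rfl (Nat.le_succ _) h) _ (by omega)).mp ?_)
          rw [← hcast]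
          exact hw ⟨(i, j), lam.up_left_mem le_rfl (Nat.le_succ _) h⟩
            (by simp only [boxDist]; omega) (by simp only [boxDist]; omega)
      have h0 : i = 0 → growth rskRule x i (j + 1) 0 = 0 := by
        rintro rfl
        rw [growth_zero_left]
        rfl
      have h0' : j = 0 → growth rskRule x (i + 1) j 0 = 0 := by
        rintro rfl
        rw [growth_zero_right]
        rfl
      have := hnn i (j + 1)
      have := hnn (i + 1) j
      omega
    · rintro hw ⟨⟨a, b⟩, hab⟩ h1 h2
      simp only [boxDist] at h1 h2
      rw [hcast]
      refine (ih a b hab _ (by omega)).mpr ?_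
      obtain ⟨rfl, rfl⟩ | ⟨rfl, rfl⟩ : a + 1 = i ∧ b = j ∨ a = i ∧ b + 1 = j := by omega
      · omega
      · omega

/-- A path through the stack of rows takes its first box and then proceeds on the same row or on the
next one. -/
theorem stack_rows_succ_iff (x : ℕ → ℕ → ℤ) (i a b : ℕ) (hab : a ≤ b) (z : ℤ) :
    stack (fun l j => ∑ c ∈ Finset.range j, x l c) (i + 1) a b z ↔
      stack (fun l j => ∑ c ∈ Finset.range j, x l c) i a b (z - x i a) ∧
      (a < b → stack (fun l j => ∑ c ∈ Finset.range j, x l c) (i + 1) (a + 1) b (z - x i a)) := by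
  have e : ∀ k, z - x i a - (∑ c ∈ Finset.range (k + 1), x i c -
      ∑ c ∈ Finset.range (a + 1), x i c) =
      z - (∑ c ∈ Finset.range (k + 1), x i c - ∑ c ∈ Finset.range a, x i c) := by
    intro k
    rw [Finset.sum_range_succ _ a]
    ring
  have e' : z - x i a = z - (∑ c ∈ Finset.range (a + 1), x i c -
      ∑ c ∈ Finset.range a, x i c) := by
    rw [Finset.sum_range_succ _ a]
    ring
  simp only [stack, lineStep]
  constructor
  · intro h
    refine ⟨e' ▸ h a le_rfl hab, fun _ k hk hkb => ?_⟩
    rw [e]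
    exact h k (by omega) hkb
  · rintro ⟨h1, h2⟩ k hk hkb
    rcases Nat.lt_or_eq_of_le hk with hk | rfl
    · rw [← e]
      exact h2 (by omega) k hk hkb
    · exact e' ▸ h1

/-- The last passage times from row `i` up to row `0` are those through the stack of rows. -/
theorem lpp_le_iff_stack {x : ℕ → ℕ → ℤ} (hx : ∀ i j, 0 ≤ x i j) {b : ℕ} (h0 : (0, b) ∈ lam)
    (i a : ℕ) (hab : a ≤ b) (h : (i, b) ∈ lam) (h' : (i, a) ∈ lam) (z : ℤ) :
    lpp (fun c : lam => (x c.1.1 c.1.2 : ℝ)) ⟨(i, a), h'⟩ ⟨(0, b), h0⟩ ≤ z ↔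
      stack (fun l j => ∑ c ∈ Finset.range j, x l c) (i + 1) a b z := by
  induction hn : i + (b - a) generalizing i a z with
  | zero =>
    obtain ⟨rfl, rfl⟩ : i = 0 ∧ a = b := by omega
    rw [lpp_self, stack_rows_succ_iff _ _ _ _ le_rfl]
    simp [stack]
  | succ n ih =>
    rw [lpp_le_iff _ (by simp only [boxDist]; omega), stack_rows_succ_iff _ _ _ _ hab]
    have hcast : (z : ℝ) - (x i a : ℝ) = ((z - x i a : ℤ) : ℝ) := by push_cast; ring
    constructor
    · intro hw
      have hright : a < b → stack (fun l j => ∑ c ∈ Finset.range j, x l c) (i + 1) (a + 1) b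
          (z - x i a) := by
        intro hlt
        have hm : (i, a + 1) ∈ lam := lam.up_left_mem le_rfl hlt h
        refine (ih i (a + 1) hlt h hm _ (by omega)).mp ?_
        rw [← hcast]
        exact hw ⟨(i, a + 1), hm⟩ (by simp only [boxDist]; omega) (by simp only [boxDist]; omega)
      refine ⟨?_, hright⟩
      rcases i with _ | i
      · have h1 := ((stack_rows_succ_iff _ _ _ _ (by omega) _).mp (hright (by omega))).1
        have h2 := hx 0 (a + 1)
        simp only [stack] at h1 ⊢
        omega
      · have hm : (i, a) ∈ lam := lam.up_left_mem (Nat.le_succ _) le_rfl h'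
        refine (ih i a hab (lam.up_left_mem (Nat.le_succ _) le_rfl h) hm _ (by omega)).mp ?_
        rw [← hcast]
        exact hw ⟨(i, a), hm⟩ (by simp only [boxDist]; omega) (by simp only [boxDist]; omega)
    · rintro ⟨h1, h2⟩ ⟨⟨c, d⟩, hcd⟩ h3 h4
      simp only [boxDist] at h3 h4
      rw [hcast]
      obtain ⟨rfl, rfl⟩ | ⟨rfl, rfl⟩ : c + 1 = i ∧ d = a ∨ c = i ∧ d = a + 1 := by omega
      · exact (ih c d hab (lam.up_left_mem (Nat.le_succ _) le_rfl h) hcd _ (by omega)).mpr h1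
      · exact (ih c (a + 1) (by omega) h hcd _ (by omega)).mpr (h2 (by omega))

/-- The Burge growth diagram computes the dual tableau. -/
theorem dualLppTableau_le_iff {x : ℕ → ℕ → ℤ} (hx : ∀ i j, 0 ≤ x i j) (i j : ℕ)
    (h : (i, j) ∈ lam) (z : ℤ) :
    dualLppTableau (fun c : lam => (x c.1.1 c.1.2 : ℝ)) ⟨(i, j), h⟩ ≤ z ↔
      growth burgeRule x (i + 1) (j + 1) 0 ≤ z := by
  rw [← stack_rows_iff hx]
  exact lpp_le_iff_stack hx _ i 0 (Nat.zero_le _) h _ z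

end Lpp

/-! ### The bijection between fillings -/

instance instFintypeBoxes (lam : YoungDiagram) : Fintype lam :=
  inferInstanceAs (Fintype lam.cells)

section Bijection

variable {lam : YoungDiagram}

/-- Natural number weights on the boxes of `lam`, extended by zero to the whole quadrant. -/
def extendZero (x : lam → ℕ) (i j : ℕ) : ℤ :=
  open Classical in if h : (i, j) ∈ lam then (x ⟨(i, j), h⟩ : ℤ) else 0

theorem extendZero_coe (x : lam → ℕ) (c : lam) : extendZero x c.1.1 c.1.2 = x c :=
  dif_pos c.2

theorem isFilling_extendZero (x : lam → ℕ) : IsFilling lam (extendZero x) where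
  nonneg i j := by
    rw [extendZero]
    split_ifs
    · exact Int.natCast_nonneg _
    · exact le_rfl
  support _ _ h := dif_neg h

theorem extendZero_injective : Function.Injective (extendZero : (lam → ℕ) → ℕ → ℕ → ℤ) := by
  intro x y h
  funext c
  have h1 := extendZero_coe x c
  rw [h, extendZero_coe] at h1
  exact_mod_cast h1.symm

theorem IsFilling.exists_extendZero {x : ℕ → ℕ → ℤ} (hx : IsFilling lam x) :
    ∃ y : lam → ℕ, extendZero y = x := by
  refine ⟨fun c => (x c.1.1 c.1.2).toNat, ?_⟩
  funext i j
  rw [extendZero]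
  split_ifs with h
  · exact Int.toNat_of_nonneg (hx.nonneg i j)
  · exact (hx.support i j h).symm

theorem exists_extendZero_growth_eq
    {R R' : ℕ → (ℕ → ℤ) → (ℕ → ℤ) → (ℕ → ℤ) → ℤ → ℕ → ℤ} (hR : IsGrowthRule R)
    (hR' : IsGrowthRule R') (x : lam → ℕ) :
    ∃ y : lam → ℕ, ∀ i j, (i, j) ∈ boundary lam →
      growth R' (extendZero y) i j = growth R (extendZero x) i j := by
  obtain ⟨y, ⟨hy, hxy⟩, -⟩ := existsUnique_filling hR' lam _
    (isBoundaryData_growth hR (isFilling_extendZero x))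
  obtain ⟨y, rfl⟩ := hy.exists_extendZero
  exact ⟨y, hxy⟩

theorem extendZero_ext_of_growth {R : ℕ → (ℕ → ℤ) → (ℕ → ℤ) → (ℕ → ℤ) → ℤ → ℕ → ℤ}
    (hR : IsGrowthRule R) {x y : lam → ℕ} (h : ∀ i j, (i, j) ∈ boundary lam →
      growth R (extendZero x) i j = growth R (extendZero y) i j) : x = y := by
  have hu := existsUnique_filling hR lam _ (isBoundaryData_growth hR (isFilling_extendZero y))
  exact extendZero_injective (hu.unique ⟨isFilling_extendZero x, h⟩
    ⟨isFilling_extendZero y, fun _ _ _ => rfl⟩)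

/-- A last passage time with integer weights is an integer, so it is determined by its integer upper
bounds. -/
theorem lpp_eq_of_forall_le_iff (x : lam → ℤ) (u v : lam) (n : ℤ)
    (h : ∀ z : ℤ, lpp (fun c => (x c : ℝ)) u v ≤ z ↔ n ≤ z) :
    lpp (fun c => (x c : ℝ)) u v = n := by
  obtain ⟨⟨π, -, hπ⟩, -⟩ := isGreatest_lpp (fun c => (x c : ℝ)) u v
  rw [← Int.cast_sum] at hπ
  rw [hπ] at h ⊢
  have h1 := (h n).mpr le_rfl
  have h2 := (h _).mp le_rfl
  exact le_antisymm h1 (Int.cast_le.mpr h2)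

theorem lppTableau_eq_growth (x : lam → ℕ) (c : lam) :
    lppTableau (fun b => (x b : ℝ)) c =
      growth rskRule (extendZero x) (c.1.1 + 1) (c.1.2 + 1) 0 := by
  have h := lpp_eq_of_forall_le_iff (fun b : lam => extendZero x b.1.1 b.1.2) (origin c) c _
    (lppTableau_le_iff (isFilling_extendZero x).nonneg c.1.1 c.1.2 c.2)
  simpa only [extendZero_coe, Int.cast_natCast, lppTableau] using h

theorem dualLppTableau_eq_growth (x : lam → ℕ) (c : lam) :
    dualLppTableau (fun b => (x b : ℝ)) c =
      growth burgeRule (extendZero x) (c.1.1 + 1) (c.1.2 + 1) 0 := by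
  have h := lpp_eq_of_forall_le_iff (fun b : lam => extendZero x b.1.1 b.1.2) (rowStart c)
    (colStart c) _ (dualLppTableau_le_iff (isFilling_extendZero x).nonneg c.1.1 c.1.2 c.2)
  simpa only [extendZero_coe, Int.cast_natCast, dualLppTableau] using h

theorem mem_boundary_of_mem_borderStrip {c : lam} (hc : c ∈ borderStrip lam) :
    (c.1.1 + 1, c.1.2 + 1) ∈ boundary lam := by
  refine ⟨hc, fun a b h => ?_⟩
  obtain ⟨h1, h2⟩ := Prod.mk.inj h
  rw [← Nat.succ_injective h1, ← Nat.succ_injective h2]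
  exact c.2

/-- The Robinson-Schensted-Knuth correspondence followed by the inverse of the Burge correspondence:
a bijection of the natural number weights on the boxes of `lam` that preserves the total weight and
turns the border strip of the last passage tableau into that of the dual tableau. -/
theorem exists_equiv_dualLppTableau_eq (lam : YoungDiagram) :
    ∃ e : (lam → ℕ) ≃ (lam → ℕ), ∀ x, ∑ c, e x c = ∑ c, x c ∧ ∀ c ∈ borderStrip lam,
      dualLppTableau (fun b => (e x b : ℝ)) c = lppTableau (fun b => (x b : ℝ)) c := by
  choose e he using
    exists_extendZero_growth_eq (lam := lam) rskRule_isGrowthRule burgeRule_isGrowthRule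
  have hinj : Function.Injective e := by
    intro x y hxy
    refine extendZero_ext_of_growth rskRule_isGrowthRule fun i j hij => ?_
    rw [← he x i j hij, ← he y i j hij, hxy]
  have hsurj : Function.Surjective e := by
    intro y
    obtain ⟨x, hx⟩ := exists_extendZero_growth_eq burgeRule_isGrowthRule rskRule_isGrowthRule y
    refine ⟨x, extendZero_ext_of_growth burgeRule_isGrowthRule fun i j hij => ?_⟩
    rw [he x i j hij, hx i j hij]
  refine ⟨Equiv.ofBijective e ⟨hinj, hsurj⟩, fun x => ⟨?_, fun c hc => ?_⟩⟩
  · have h := sum_filling_eq burgeRule_isGrowthRule rskRule_isGrowthRule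
      (isFilling_extendZero (e x)) (isFilling_extendZero x) (he x)
    have hs : ∀ y : lam → ℕ, ∑ c ∈ lam.cells, extendZero y c.1 c.2 = ((∑ c, y c : ℕ) : ℤ) := by
      intro y
      rw [Nat.cast_sum, ← Finset.sum_coe_sort]
      exact Finset.sum_congr rfl fun c _ => extendZero_coe y c
    rw [hs, hs] at h
    exact_mod_cast h
  · rw [lppTableau_eq_growth, dualLppTableau_eq_growth]
    exact_mod_cast congrFun (he x _ _ (mem_boundary_of_mem_borderStrip hc)) 0

end Bijection

/-! ### Continuity and homogeneity -/

section Continuity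

variable {lam : YoungDiagram}

open scoped Pointwise in
theorem lpp_mul_left (x : lam → ℝ) (u v : lam) {r : ℝ} (hr : 0 ≤ r) :
    lpp (fun c => r * x c) u v = r * lpp x u v := by
  have h : pathWeights (fun c => r * x c) u v = r • pathWeights x u v := by
    ext s
    constructor
    · rintro ⟨π, hπ, rfl⟩
      exact ⟨_, ⟨π, hπ, rfl⟩, Finset.mul_sum _ _ _⟩
    · rintro ⟨_, ⟨π, hπ, rfl⟩, rfl⟩
      exact ⟨π, hπ, Finset.mul_sum _ _ _⟩
  rw [lpp, h, Real.sSup_smul_of_nonneg hr, smul_eq_mul, lpp]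

theorem continuous_lpp (u v : lam) : Continuous fun x : lam → ℝ => lpp x u v := by
  classical
  set s : Finset (Fin (boxDist u v + 1) → lam) := Finset.univ.filter fun π => IsDirectedPath u v π
    with hs
  have hne : s.Nonempty := by
    obtain ⟨π, hπ⟩ := exists_latticePath v _ u rfl
    exact ⟨π, Finset.mem_filter.mpr ⟨Finset.mem_univ _, hπ⟩⟩
  have heq : (fun x : lam → ℝ => lpp x u v) = fun x => s.sup' hne fun π => ∑ k, x (π k) := by
    funext x
    refine (isGreatest_lpp x u v).unique ⟨?_, ?_⟩
    · obtain ⟨π, hπ, h⟩ := Finset.exists_mem_eq_sup' hne fun π => ∑ k, x (π k)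
      exact ⟨π, (Finset.mem_filter.mp hπ).2, h⟩
    · rintro _ ⟨π, hπ, rfl⟩
      exact Finset.le_sup' (fun π => ∑ k, x (π k))
        (Finset.mem_filter.mpr ⟨Finset.mem_univ _, hπ⟩)
  rw [heq]
  exact Continuous.finset_sup'_apply hne fun π _ => by fun_prop

theorem continuous_lppTableau (s : Set lam) :
    Continuous fun (x : lam → ℝ) (c : s) => lppTableau x c :=
  continuous_pi fun c => continuous_lpp (origin c.1) c.1

theorem continuous_dualLppTableau (s : Set lam) :
    Continuous fun (x : lam → ℝ) (c : s) => dualLppTableau x c :=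
  continuous_pi fun c => continuous_lpp (rowStart c.1) (colStart c.1)

end Continuity

/-! ### Geometric weights -/

/-- The distribution of independent geometric weights on the boxes of `lam`. -/
noncomputable def geometricWeights (lam : YoungDiagram) (p : unitInterval) : Measure (lam → ℕ) :=
  Measure.pi fun _ => geometricMeasure p

/-- The probability of a configuration of geometric weights depends only on its total weight. -/
theorem geometricWeights_singleton (lam : YoungDiagram) {p : unitInterval} (hp : p ≠ 0)
    (x : lam → ℕ) : geometricWeights lam p {x} =
      ENNReal.ofReal ((1 - p) ^ (∑ c, x c) * p ^ Fintype.card lam) := by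
  rw [geometricWeights, Measure.pi_singleton]
  simp only [geometricMeasure_singleton hp]
  rw [← ENNReal.ofReal_prod_of_nonneg fun c _ => geometricMeasure_nonneg p (x c),
    Finset.prod_mul_distrib, Finset.prod_pow_eq_pow_sum, Finset.prod_const, Finset.card_univ]

theorem map_geometricWeights (lam : YoungDiagram) {p : unitInterval} (hp : p ≠ 0)
    (e : (lam → ℕ) ≃ (lam → ℕ)) (he : ∀ x, ∑ c, e x c = ∑ c, x c) :
    (geometricWeights lam p).map e = geometricWeights lam p := by
  refine Measure.ext_of_singleton fun x => ?_
  have hpre : e ⁻¹' {x} = {e.symm x} := Set.ext fun y => e.eq_symm_apply.symm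
  rw [Measure.map_apply .of_discrete (measurableSet_singleton x), hpre,
    geometricWeights_singleton lam hp, geometricWeights_singleton lam hp, ← he (e.symm x),
    e.apply_symm_apply]

/-- The theorem for geometric weights, scaled by a nonnegative factor `r`. -/
theorem map_lppTableau_geometricWeights (lam : YoungDiagram) {p : unitInterval} (hp : p ≠ 0)
    {r : ℝ} (hr : 0 ≤ r) :
    (geometricWeights lam p).map
        (fun x (c : borderStrip lam) => lppTableau (fun b => r * (x b : ℝ)) c) =
      (geometricWeights lam p).map
        (fun x (c : borderStrip lam) => dualLppTableau (fun b => r * (x b : ℝ)) c) := by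
  obtain ⟨e, he⟩ := exists_equiv_dualLppTableau_eq lam
  conv_rhs => rw [← map_geometricWeights lam hp e fun x => (he x).1]
  rw [Measure.map_map .of_discrete .of_discrete]
  congr 1
  funext x c
  have h := (he x).2 c c.2
  simp only [Function.comp_apply, lppTableau, dualLppTableau, lpp_mul_left _ _ _ hr] at h ⊢
  rw [h]

/-! ### Exponential weights -/

open Filter Topology in
/-- The integer part of an exponential random variable is geometric, for every mesh `1 / t`. -/
theorem map_floor_expMeasure {r t : ℝ} (hr : 0 < r) (ht : 0 < t) :
    ∃ p : unitInterval, p ≠ 0 ∧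
      (expMeasure r).map (fun x => ⌊x * t⌋₊) = geometricMeasure p := by
  have := isProbabilityMeasure_expMeasure hr
  have hac : expMeasure r ≪ volume := withDensity_absolutelyContinuous _ _
  have hna : NullSingletonClass (expMeasure r) := ⟨fun x => hac (measure_singleton x)⟩
  have hexp : Real.exp (-(r / t)) < 1 := 
    Real.exp_lt_one_iff.mpr (by linarith [div_pos hr ht])
  refine ⟨⟨1 - Real.exp (-(r / t)), by linarith, by have := Real.exp_pos (-(r / t)); linarith⟩,
    fun h => ?_, ?_⟩
  · have := congrArg Subtype.val h
    simp only [Set.Icc.coe_zero] at this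
    linarith
  refine Measure.ext_of_singleton fun n => ?_
  rw [geometricMeasure_singleton, Measure.map_apply (by fun_prop) (measurableSet_singleton n)]
  swap
  · intro h
    have := congrArg Subtype.val h
    simp only [Set.Icc.coe_zero] at this
    linarith
  have hpos : ∀ᵐ x ∂expMeasure r, 0 < x := by
    rw [ae_iff]
    simp only [not_lt]
    change expMeasure r (Set.Iic 0) = 0
    rw [← ofReal_cdf, cdf_expMeasure_eq hr]
    simp
  have hset : (fun x => ⌊x * t⌋₊) ⁻¹' {n} =ᵐ[expMeasure r]
      Set.Ico ((n : ℝ) / t) (((n : ℝ) + 1) / t) := by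
    filter_upwards [hpos] with x hx
    refine propext ?_
    change ⌊x * t⌋₊ = n ↔ (n : ℝ) / t ≤ x ∧ x < ((n : ℝ) + 1) / t
    rw [Nat.floor_eq_iff (by positivity), div_le_iff₀ ht, lt_div_iff₀ ht]
  have h0 : (0 : ℝ) ≤ (n : ℝ) / t := by positivity
  have h1 : (0 : ℝ) ≤ ((n : ℝ) + 1) / t := by positivity
  rw [measure_congr hset, measure_congr Ico_ae_eq_Ioc, ← measure_cdf (expMeasure r),
    StieltjesFunction.measure_Ioc, cdf_expMeasure_eq hr, cdf_expMeasure_eq hr, if_pos h0, if_pos h1]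
  congr 1
  have e1 : -(r * ((n : ℝ) / t)) = n * (-(r / t)) := by ring
  have e2 : -(r * (((n : ℝ) + 1) / t)) = n * (-(r / t)) + -(r / t) := by ring
  rw [e1, e2, Real.exp_add, Real.exp_nat_mul]
  simp only [sub_sub_cancel]
  ring

section Law

variable {Ω : Type*} [MeasurableSpace Ω] {P : Measure Ω} {lam : YoungDiagram} {X : lam → Ω → ℝ}

theorem map_lppTableau_geometric (hindep : iIndepFun X P) {p : unitInterval} (hp : p ≠ 0)
    (hlaw : ∀ c, HasLaw (X c) (geometricReal p) P) :
    P.map (fun ω (c : borderStrip lam) => lppTableau (fun b => X b ω) c) =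
      P.map (fun ω (c : borderStrip lam) => dualLppTableau (fun b => X b ω) c) := by
  have hX : AEMeasurable (fun ω b => X b ω) P :=
    aemeasurable_pi_lambda _ fun b => (hlaw b).aemeasurable
  have hmap : P.map (fun ω b => X b ω) =
      (geometricWeights lam p).map (fun x b => (x b : ℝ)) := by
    have hprob : IsProbabilityMeasure ((geometricMeasure p).map fun n : ℕ => (n : ℝ)) :=
      Measure.isProbabilityMeasure_map (by fun_prop)
    rw [(hindep.hasLaw_pi hlaw).map_eq, geometricWeights]
    exact (Measure.pi_map_pi (f := fun (_ : lam) (n : ℕ) => (n : ℝ)) fun _ => by fun_prop).symm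
  have key := map_lppTableau_geometricWeights lam hp zero_le_one
  simp only [one_mul] at key
  have push : ∀ F : (lam → ℝ) → borderStrip lam → ℝ, Continuous F →
      P.map (fun ω => F fun b => X b ω) =
        (geometricWeights lam p).map fun x => F fun b => (x b : ℝ) := by
    intro F hF
    have h1 := AEMeasurable.map_map_of_aemeasurable (μ := P) hF.measurable.aemeasurable hX
    rw [hmap, Measure.map_map hF.measurable .of_discrete] at h1
    exact h1.symm
  exact (push _ (continuous_lppTableau _)).trans
    (key.trans (push _ (continuous_dualLppTableau _)).symm)

open Filter Topology in
/-- Exponential weights are the limit, as `k` tends to infinity, of geometric weights that are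
scaled by `1 / (k + 1)`; the last passage times are continuous in the weights. -/
theorem map_lppTableau_exponential [IsProbabilityMeasure P] (hindep : iIndepFun X P) {r : ℝ}
    (hr : 0 < r) (hlaw : ∀ c, HasLaw (X c) (expMeasure r) P) :
    P.map (fun ω (c : borderStrip lam) => lppTableau (fun b => X b ω) c) =
      P.map (fun ω (c : borderStrip lam) => dualLppTableau (fun b => X b ω) c) := by
  have hX : AEMeasurable (fun ω b => X b ω) P :=
    aemeasurable_pi_lambda _ fun b => (hlaw b).aemeasurable
  have := isProbabilityMeasure_expMeasure hr
  have hnonneg : ∀ᵐ ω ∂P, ∀ b, 0 ≤ X b ω := by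
    rw [ae_all_iff]
    intro b
    have hset : MeasurableSet {x : ℝ | x < 0} := measurableSet_Iio
    have h := (hlaw b).measure_eq (p := fun x => x < 0) hset
    rw [ae_iff]
    simp only [not_le]
    rw [h]
    refine measure_mono_null (t := Set.Iic 0) (fun x (hx : x < 0) => Set.mem_Iic.mpr hx.le) ?_
    rw [← ofReal_cdf, cdf_expMeasure_eq hr]
    simp
  -- the weights rounded down to multiples of `1 / (k + 1)`
  set Y : ℕ → Ω → lam → ℝ := fun k ω b => (⌊X b ω * ((k : ℝ) + 1)⌋₊ : ℝ) / ((k : ℝ) + 1) with hY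
  have hYm : ∀ k, AEMeasurable (Y k) P := by
    intro k
    refine aemeasurable_pi_lambda _ fun b => ?_
    have hm : Measurable fun x : ℝ => (⌊x * ((k : ℝ) + 1)⌋₊ : ℝ) / ((k : ℝ) + 1) := by fun_prop
    exact hm.comp_aemeasurable (hlaw b).aemeasurable
  have hYX : ∀ᵐ ω ∂P, Tendsto (fun k => Y k ω) atTop (𝓝 fun b => X b ω) := by
    filter_upwards [hnonneg] with ω hω
    refine tendsto_pi_nhds.mpr fun b => ?_
    exact (tendsto_nat_floor_mul_div_atTop (hω b)).comp
      (tendsto_atTop_add_const_right _ _ tendsto_natCast_atTop_atTop)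
  have hYlaw : ∀ k, P.map (fun ω (c : borderStrip lam) => lppTableau (Y k ω) c) =
      P.map (fun ω (c : borderStrip lam) => dualLppTableau (Y k ω) c) := by
    intro k
    have ht : (0 : ℝ) < (k : ℝ) + 1 := by positivity
    obtain ⟨p, hp, hfloor⟩ := map_floor_expMeasure hr ht
    have hm : Measurable fun x : ℝ => ⌊x * ((k : ℝ) + 1)⌋₊ := by fun_prop
    have hlawN : ∀ b, HasLaw (fun ω => ⌊X b ω * ((k : ℝ) + 1)⌋₊) (geometricMeasure p) P :=
      fun b =>
        HasLaw.fun_comp (Y := fun x : ℝ => ⌊x * ((k : ℝ) + 1)⌋₊) ⟨hm.aemeasurable, hfloor⟩ (hlaw b)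
    have hN := (hindep.comp (fun _ => _) fun _ => hm).hasLaw_pi hlawN
    have key := map_lppTableau_geometricWeights lam hp (inv_pos.mpr ht).le
    have push : ∀ F : (lam → ℝ) → borderStrip lam → ℝ,
        P.map (fun ω => F (Y k ω)) = (geometricWeights lam p).map
          fun x => F fun b => ((k : ℝ) + 1)⁻¹ * (x b : ℝ) := by
      intro F
      rw [geometricWeights, ← hN.map_eq,
        AEMeasurable.map_map_of_aemeasurable (Measurable.of_discrete.aemeasurable) hN.aemeasurable]
      congr 1
      funext ω
      simp only [hY, Function.comp_apply, div_eq_inv_mul]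
    exact (push fun y c => lppTableau y c).trans
      (key.trans (push fun y c => dualLppTableau y c).symm)
  have hlim : ∀ F : (lam → ℝ) → borderStrip lam → ℝ, Continuous F →
      ∀ f : BoundedContinuousFunction (borderStrip lam → ℝ) ℝ,
        Tendsto (fun k => ∫ y, f y ∂P.map fun ω => F (Y k ω)) atTop
          (𝓝 (∫ y, f y ∂P.map fun ω => F fun b => X b ω)) := by
    intro F hF f
    have hint : ∀ Z : Ω → lam → ℝ, AEMeasurable Z P →
        ∫ y, f y ∂P.map (fun ω => F (Z ω)) = ∫ ω, f (F (Z ω)) ∂P := fun Z hZ =>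
      integral_map (hF.measurable.comp_aemeasurable hZ) f.continuous.aestronglyMeasurable
    rw [hint _ hX]
    simp only [hint _ (hYm _)]
    refine tendsto_integral_of_dominated_convergence (fun _ => ‖f‖) (fun k => ?_)
      (integrable_const _) (fun k => .of_forall fun ω => f.norm_coe_le_norm _) ?_
    · exact ((f.continuous.comp hF).measurable.comp_aemeasurable (hYm k)).aestronglyMeasurable
    · filter_upwards [hYX] with ω hω
      exact ((f.continuous.comp hF).tendsto _).comp hω
  have hprob : ∀ F : (lam → ℝ) → borderStrip lam → ℝ, Continuous F →
      IsProbabilityMeasure (P.map fun ω => F fun b => X b ω) := fun F hF =>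
    Measure.isProbabilityMeasure_map (hF.measurable.comp_aemeasurable hX)
  have := hprob _ (continuous_lppTableau (borderStrip lam))
  have := hprob _ (continuous_dualLppTableau (borderStrip lam))
  refine ext_of_forall_integral_eq_of_IsFiniteMeasure fun f => ?_
  refine tendsto_nhds_unique (hlim _ (continuous_lppTableau _) f) ?_
  simp only [hYlaw]
  exact hlim _ (continuous_dualLppTableau _) f

end Law

theorem corners_subset_borderStrip (lam : YoungDiagram) : corners lam ⊆ borderStrip lam := by
  rintro c ⟨nu, hnu⟩ hmem
  have h1 : (c.1.1 + 1, c.1.2 + 1) ∈ nu := by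
    rw [← YoungDiagram.mem_cells, hnu, Finset.mem_erase]
    refine ⟨fun h => ?_, hmem⟩
    exact absurd (congrArg Prod.fst h) (Nat.succ_ne_self _)
  have h2 := nu.up_left_mem (Nat.le_succ c.1.1) (Nat.le_succ c.1.2) h1
  rw [← YoungDiagram.mem_cells, hnu] at h2
  exact Finset.notMem_erase _ _ h2

end YoungLPP

theorem mainTheorem1 {Ω : Type*} [MeasurableSpace Ω] (P : Measure Ω) [IsProbabilityMeasure P]
    (lam : YoungDiagram) (X : lam → Ω → ℝ)
    (hindep : iIndepFun X P)
    (hlaw : (∃ p : unitInterval, 0 < p ∧ p < 1 ∧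
          ∀ c, HasLaw (X c) (YoungLPP.geometricReal p) P) ∨
        (∃ α : ℝ, 0 < α ∧ ∀ c, HasLaw (X c) (expMeasure α) P)) :
    IdentDistrib
        (fun ω (c : YoungLPP.borderStrip lam) => YoungLPP.lppTableau (fun b => X b ω) c)
        (fun ω (c : YoungLPP.borderStrip lam) => YoungLPP.dualLppTableau (fun b => X b ω) c)
        P P ∧
      IdentDistrib
        (fun ω (c : YoungLPP.corners lam) => YoungLPP.lppTableau (fun b => X b ω) c)
        (fun ω (c : YoungLPP.corners lam) => YoungLPP.dualLppTableau (fun b => X b ω) c)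
        P P := by
  have hX : AEMeasurable (fun ω b => X b ω) P := by
    refine aemeasurable_pi_lambda _ fun b => ?_
    rcases hlaw with ⟨p, -, -, h⟩ | ⟨α, -, h⟩
    · exact (h b).aemeasurable
    · exact (h b).aemeasurable
  have border : IdentDistrib
      (fun ω (c : YoungLPP.borderStrip lam) => YoungLPP.lppTableau (fun b => X b ω) c)
      (fun ω (c : YoungLPP.borderStrip lam) => YoungLPP.dualLppTableau (fun b => X b ω) c)
      P P :=
    { aemeasurable_fst := (YoungLPP.continuous_lppTableau _).measurable.comp_aemeasurable hX
      aemeasurable_snd := (YoungLPP.continuous_dualLppTableau _).measurable.comp_aemeasurable hX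
      map_eq := by
        rcases hlaw with ⟨p, hp, -, h⟩ | ⟨α, hα, h⟩
        · exact YoungLPP.map_lppTableau_geometric hindep hp.ne' h
        · exact YoungLPP.map_lppTableau_exponential hindep hα h }
  refine ⟨border, ?_⟩
  exact border.comp (u := fun y (c : YoungLPP.corners lam) =>
    y ⟨c.1, YoungLPP.corners_subset_borderStrip lam c.2⟩) (by fun_prop)
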